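/- Let $I\subseteq\mathbb R$ be a nondegenerate interval (open or not; derivatives at an endpoint belonging to $I$ are one-sided). For a continuous, strictly monotone $h\colon I\to\mathbb R$ let $\mathscr A^{[h]}\colon\bigcup_{n\ge1}I^n\to I$ be the quasiarithmetic mean $$\mathscr A^{[h]}(x_1,\dots,x_n)=h^{-1}\Big(\frac{h(x_1)+\cdots+h(x_n)}n\Big).$$ Let $\mathcal Q(I)$ be the family of all these means, and let $\mathcal C^{2\#}(I)$ be the class of $C^2$ functions on $I$ whose first derivative vanishes nowhere on $I$. A mean in $\mathcal Q(I)$ is called Jensen convex if its restriction to $I^n$ is Jensen (midpoint) convex for every $n\ge1$. For $M\in\mathcal Q(I)$ put $$\operatorname{conv}_{\mathcal Q(I)}(M)(x)=\sup\{N(x): N\in\mathcal Q(I),\ N\text{ is Jensen convex},\ N\le M\}\in[-\infty,+\infty)\qquad\Big(x\in\bigcup_{n\ge1}I^n\Big),$$ where $N\le M$ is meant pointwise on $\bigcup_{n\ge1}I^n$. For $\varphi\colon I\to\mathbb R$ put $$\operatorname{conc}_{\mathcal C(I)}(\varphi)(x)=\inf\{k(x): k\colon I\to\mathbb R\text{ continuous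 and Jensen concave},\ k\ge\varphi\}\in(-\infty,+\infty]\qquad(x\in I).$$ **Theorem.** Let $f\in\mathcal C^{2\#}(I)$ be strictly increasing and convex. Then there is $g\in\mathcal C^{2\#}(I)$ such that $\operatorname{conv}_{\mathcal Q(I)}(\mathscr A^{[f]})=\mathscr A^{[g]}$ on $\bigcup_{n\ge1}I^n$ and one of the following holds: 1. $g''\equiv0$ on $I$, and $\mathscr A^{[g]}$ is the arithmetic mean; 2. $g''$ vanishes nowhere on $I$, $f''$ vanishes nowhere on $I$, and $\dfrac{g'}{g''}=\operatorname{conc}_{\mathcal C(I)}\Big(\dfrac{f'}{f''}\Big)$ on $I$. -/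

import Mathlib

noncomputable section

namespace QAEnvelope

/-- A function of an arbitrary finite number of real variables. Only its values at nonempty
tuples with entries in the interval under consideration are ever used. -/
abbrev MultiFun : Type := (n : ℕ) → (Fin n → ℝ) → ℝ

/-- The set `Iⁿ`. -/
def cube (I : Set ℝ) (n : ℕ) : Set (Fin n → ℝ) := {x | ∀ i, x i ∈ I}

/-- Jensen (midpoint) convexity on `D`. -/
def JensenConvexOn {X : Type*} [AddCommGroup X] [Module ℝ X] (D : Set X) (g : X → ℝ) : Prop :=
  ∀ x ∈ D, ∀ y ∈ D, g (midpoint ℝ x y) ≤ (g x + g y) / 2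

/-- Jensen (midpoint) concavity on `D`. -/
def JensenConcaveOn {X : Type*} [AddCommGroup X] [Module ℝ X] (D : Set X) (g : X → ℝ) : Prop :=
  ∀ x ∈ D, ∀ y ∈ D, (g x + g y) / 2 ≤ g (midpoint ℝ x y)

/-- The `S`-concave envelope of `φ` on `D`: the pointwise infimum, in the extended reals, of the
Jensen concave members of `S` that majorize `φ` on `D`. -/
def concEnvelope {X : Type*} [AddCommGroup X] [Module ℝ X] (D : Set X) (S : Set (X → ℝ))
    (φ : X → ℝ) (x : X) : EReal :=
  sInf {r : EReal | ∃ k ∈ S, JensenConcaveOn D k ∧ (∀ y ∈ D, φ y ≤ k y) ∧ r = (k x : EReal)}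

/-- A function on `⋃ₙ Iⁿ` (`n ≥ 1`) is Jensen convex if each of its restrictions to `Iⁿ` is. -/
def MultiJensenConvexOn (I : Set ℝ) (M : MultiFun) : Prop :=
  ∀ n : ℕ, 0 < n → JensenConvexOn (cube I n) (M n)

/-- The pointwise inequality `M ≤ N` on `⋃ₙ Iⁿ` (`n ≥ 1`). -/
def MultiLeOn (I : Set ℝ) (M N : MultiFun) : Prop :=
  ∀ n : ℕ, 0 < n → ∀ x ∈ cube I n, M n x ≤ N n x

/-- The `S`-convex envelope of `M` on `⋃ₙ Iⁿ`: the pointwise supremum, in the extended reals, of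
the Jensen convex members of `S` that minorize `M`. -/
def convEnvelope (I : Set ℝ) (S : Set MultiFun) (M : MultiFun) (n : ℕ) (x : Fin n → ℝ) : EReal :=
  sSup {r : EReal | ∃ N ∈ S, MultiJensenConvexOn I N ∧ MultiLeOn I N M ∧ r = (N n x : EReal)}

/-- `h` generates a quasiarithmetic mean on `I`: it is continuous and strictly monotone on `I`. -/
def IsGenerator (I : Set ℝ) (h : ℝ → ℝ) : Prop :=
  ContinuousOn h I ∧ (StrictMonoOn h I ∨ StrictAntiOn h I)

/-- The quasiarithmetic mean `h⁻¹ ((h x₁ + ⋯ + h xₙ) / n)`, the inverse being that of `h`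
restricted to `I`. -/
def qaMean (I : Set ℝ) (h : ℝ → ℝ) : MultiFun :=
  fun n x => Function.invFunOn h I ((∑ i, h (x i)) / (n : ℝ))

/-- The family of all quasiarithmetic means on `I`. -/
def qaFamily (I : Set ℝ) : Set MultiFun := {M | ∃ h : ℝ → ℝ, IsGenerator I h ∧ M = qaMean I h}

/-- The first derivative on `I` (one-sided at an endpoint belonging to `I`). -/
def d1 (I : Set ℝ) (f : ℝ → ℝ) : ℝ → ℝ := derivWithin f I

/-- The second derivative on `I` (one-sided at an endpoint belonging to `I`). -/
def d2 (I : Set ℝ) (f : ℝ → ℝ) : ℝ → ℝ := derivWithin (derivWithin f I) I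

/-- The class of `C²` functions on `I` whose first derivative vanishes nowhere on `I`. -/
def C2sharp (I : Set ℝ) : Set (ℝ → ℝ) := {f | ContDiffOn ℝ 2 f I ∧ ∀ x ∈ I, d1 I f x ≠ 0}

end QAEnvelope

end

namespace QAEnvelope

open Set Filter Topology

/-! Means with increasing generators are ordered by `h''/h'` (`IsMeanOf.le_of_ratio_le`,
`IsMeanOf.ratio_le_of_le`), and Jensen convexity of the mean means that either `h'' = 0`, or `h'' >
0` and `h'/h''` is concave. Hence Jensen convex minorants of the mean of `f`, other than the
arithmetic one, correspond to concave majorants of `f'/f''`, and the greatest minorant to the least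
majorant `ψ`. Solving `g'/g'' = ψ` gives `g`. If no affine, hence no concave, majorant exists, only
the arithmetic mean is left.

A competing mean has a generator that is merely continuous. `IsMeanOf.structure_of_jensenConvex`
recovers enough regularity: `N (x, y, …, y)`, rescaled as the number of copies of `y` grows, yields
`(h x - h y) / h'(y)`, which inherits joint convexity; its second-order behaviour at `x = y` yields
the dichotomy. Only right derivatives on the interior result, so the comparison lemmas are stated
for these. That the mean of `g` is convex is `IsMeanOf.jensenConvexOn_of_isOpen`, by Cauchy–Schwarz.
Endpoints are reached by continuity. -/

/-! ### Midpoint convexity and continuity -/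

lemma nonpos_of_midpoint_convex {φ : ℝ → ℝ} (hc : ContinuousOn φ (Icc 0 1))
    (hm : ∀ s ∈ Icc (0 : ℝ) 1, ∀ t ∈ Icc (0 : ℝ) 1, φ ((s + t) / 2) ≤ (φ s + φ t) / 2)
    (h0 : φ 0 ≤ 0) (h1 : φ 1 ≤ 0) {t : ℝ} (ht : t ∈ Icc (0 : ℝ) 1) : φ t ≤ 0 := by
  obtain ⟨u, hu, hmax⟩ := isCompact_Icc.exists_isMaxOn ⟨t, ht⟩ hc
  by_contra! hpos
  have hM : 0 < φ u := hpos.trans_le (hmax ht)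
  have hK : IsCompact (Icc (0 : ℝ) 1 ∩ φ ⁻¹' {φ u}) :=
    isCompact_Icc.of_isClosed_subset
      (hc.preimage_isClosed_of_isClosed isClosed_Icc isClosed_singleton) inter_subset_left
  -- The leftmost maximum point: it is interior, and the midpoint inequality around it forces the
  -- maximum to be attained further left.
  obtain ⟨v, ⟨hv, hvu⟩, hleast⟩ := hK.exists_isLeast ⟨u, hu, rfl⟩
  have hvu : φ v = φ u := hvu
  have hv0 : 0 < v := lt_of_le_of_ne hv.1 (by rintro rfl; linarith)
  have hv1 : v < 1 := lt_of_le_of_ne hv.2 (by rintro rfl; linarith)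
  have hδ : 0 < min v (1 - v) := lt_min hv0 (by linarith)
  have hδ1 := min_le_left v (1 - v)
  have hδ2 := min_le_right v (1 - v)
  set δ := min v (1 - v)
  have ha : v - δ ∈ Icc (0 : ℝ) 1 := ⟨by linarith, by linarith⟩
  have hb : v + δ ∈ Icc (0 : ℝ) 1 := ⟨by linarith, by linarith⟩
  have h := hm _ ha _ hb
  rw [show (v - δ + (v + δ)) / 2 = v by ring] at h
  have h2 : φ (v + δ) ≤ φ u := hmax hb
  have h3 : φ (v - δ) ≤ φ u := hmax ha
  have h4 : φ (v - δ) = φ u := by linarith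
  have := hleast ⟨ha, h4⟩
  linarith

/-- A continuous Jensen convex function is convex. -/
lemma JensenConvexOn.convexOn {X : Type*} [AddCommGroup X] [Module ℝ X] [TopologicalSpace X]
    [ContinuousAdd X] [ContinuousSMul ℝ X] {D : Set X} {g : X → ℝ} (hD : Convex ℝ D)
    (hg : ContinuousOn g D) (hJ : JensenConvexOn D g) : ConvexOn ℝ D g := by
  refine ⟨hD, fun x hx y hy a b ha hb hab => ?_⟩
  have hmem : ∀ t ∈ Icc (0 : ℝ) 1, (1 - t) • x + t • y ∈ D := fun t ht =>
    hD hx hy (by linarith [ht.2]) ht.1 (by ring)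
  have key := nonpos_of_midpoint_convex
    (φ := fun t => g ((1 - t) • x + t • y) - ((1 - t) * g x + t * g y)) ?_ ?_ (by simp) (by simp)
    (t := b) ⟨hb, by linarith⟩
  · obtain rfl : a = 1 - b := by linarith
    simpa using key
  · refine ContinuousOn.sub (hg.comp ?_ hmem) ?_
    · exact Continuous.continuousOn (by fun_prop)
    · exact Continuous.continuousOn (by fun_prop)
  · intro s hs t ht
    have h := hJ _ (hmem s hs) _ (hmem t ht)
    have hm : midpoint ℝ ((1 - s) • x + s • y) ((1 - t) • x + t • y)
        = (1 - (s + t) / 2) • x + ((s + t) / 2) • y := by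
      rw [midpoint_eq_smul_add, invOf_eq_inv]
      module
    rw [hm] at h
    linarith

lemma JensenConcaveOn.concaveOn {X : Type*} [AddCommGroup X] [Module ℝ X] [TopologicalSpace X]
    [ContinuousAdd X] [ContinuousSMul ℝ X] {D : Set X} {g : X → ℝ} (hD : Convex ℝ D)
    (hg : ContinuousOn g D) (hJ : JensenConcaveOn D g) : ConcaveOn ℝ D g := by
  rw [← neg_convexOn_iff]
  refine JensenConvexOn.convexOn hD hg.neg fun x hx y hy => ?_
  have := hJ x hx y hy
  simp only [Pi.neg_apply]
  linarith

lemma _root_.ConcaveOn.jensenConcaveOn {X : Type*} [AddCommGroup X] [Module ℝ X] {D : Set X}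
    {g : X → ℝ} (hg : ConcaveOn ℝ D g) : JensenConcaveOn D g := by
  intro x hx y hy
  have := hg.2 hx hy (show (0 : ℝ) ≤ 1 / 2 by norm_num) (show (0 : ℝ) ≤ 1 / 2 by norm_num)
    (by norm_num)
  rw [midpoint_eq_smul_add, smul_add, invOf_eq_inv, ← one_div]
  simp only [smul_eq_mul] at this
  linarith

/-! ### Right derivatives -/

/-- The mean value inequality needs a right derivative at the left end, so it is applied on `[c, b]`
and `c` tends to `a`. -/
lemma le_of_rightDeriv_nonneg {T T' : ℝ → ℝ} {a b : ℝ} (hab : a ≤ b)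
    (hT : ContinuousOn T (Icc a b))
    (hd : ∀ x ∈ Ioo a b, HasDerivWithinAt T (T' x) (Ioi x) x) (hn : ∀ x ∈ Ioo a b, 0 ≤ T' x) :
    T a ≤ T b := by
  rcases hab.eq_or_lt with rfl | hab
  · rfl
  have hlim : Tendsto T (𝓝[>] a) (𝓝 (T a)) :=
    ((hT a (left_mem_Icc.2 hab.le)).mono_left
      (nhdsWithin_le_iff.2 (Icc_mem_nhdsGT hab)))
  refine le_of_tendsto hlim ?_
  filter_upwards [Ioo_mem_nhdsGT hab] with c hc
  have hsub : ∀ x ∈ Ico c b, x ∈ Ioo a b := fun x hx => ⟨hc.1.trans_le hx.1, hx.2⟩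
  refine image_le_of_deriv_right_le_deriv_boundary (f := fun _ => T c) (f' := 0)
    continuousOn_const (fun x _ => hasDerivWithinAt_const _ _ _) le_rfl
    (hT.mono (Icc_subset_Icc_left hc.1.le))
    (fun x hx => (hd x (hsub x hx)).Ici_of_Ioi) (fun x hx => hn x (hsub x hx))
    (right_mem_Icc.2 hc.2.le)

lemma _root_.Set.OrdConnected.Ioo_subset_interior {I : Set ℝ} (hI : I.OrdConnected) {a b : ℝ}
    (ha : a ∈ I) (hb : b ∈ I) : Ioo a b ⊆ interior I :=
  interior_maximal (Ioo_subset_Icc_self.trans (hI.out ha hb)) isOpen_Ioo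

lemma _root_.Set.OrdConnected.subset_closure_interior {I : Set ℝ} (hI : I.OrdConnected)
    (hne : I.Nontrivial) : I ⊆ closure (interior I) := by
  obtain ⟨a, ha, b, hb, hab⟩ := hne.exists_lt
  rw [(hI.convex (𝕜 := ℝ)).closure_interior_eq_closure_of_nonempty_interior
    ((nonempty_Ioo.2 hab).mono (hI.Ioo_subset_interior ha hb))]
  exact subset_closure

lemma le_on_of_le_on_interior {I : Set ℝ} (hI : I.OrdConnected) (hne : I.Nontrivial)
    {u v : ℝ → ℝ} (hu : ContinuousOn u I) (hv : ContinuousOn v I)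
    (h : ∀ x ∈ interior I, u x ≤ v x) : ∀ x ∈ I, u x ≤ v x := by
  intro x hx
  have hcl := hI.subset_closure_interior hne hx
  have : (𝓝[interior I] x).NeBot := mem_closure_iff_nhdsWithin_neBot.1 hcl
  exact le_of_tendsto_of_tendsto ((hu x hx).mono interior_subset) ((hv x hx).mono interior_subset)
    (eventually_mem_nhdsWithin.mono h)

lemma isMinOn_of_rightDeriv {I : Set ℝ} (hI : I.OrdConnected) {T T' : ℝ → ℝ} {m : ℝ} (hm : m ∈ I)
    (hT : ContinuousOn T I)
    (hd : ∀ x ∈ interior I, HasDerivWithinAt T (T' x) (Ioi x) x)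
    (hr : ∀ x ∈ interior I, m < x → 0 ≤ T' x) (hl : ∀ x ∈ interior I, x < m → T' x ≤ 0)
    {x : ℝ} (hx : x ∈ I) : T m ≤ T x := by
  rcases le_total m x with h | h
  · have hs := hI.Ioo_subset_interior hm hx
    exact le_of_rightDeriv_nonneg h (hT.mono (hI.out hm hx)) (fun y hy => hd y (hs hy))
      fun y hy => hr y (hs hy) hy.1
  · have hs := hI.Ioo_subset_interior hx hm
    have := le_of_rightDeriv_nonneg (T := fun y => -T y) (T' := fun y => -T' y) h
      (hT.mono (hI.out hx hm)).neg (fun y hy => (hd y (hs hy)).neg)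
      fun y hy => neg_nonneg.2 (hl y (hs hy) hy.2)
    linarith

/-! ### Quasiarithmetic means and their comparison -/

/-- `d` is a continuous positive right derivative of `h` on `U`, and `e` is a right derivative
of `d`. -/
structure RightC2 (U : Set ℝ) (h d e : ℝ → ℝ) : Prop where
  pos : ∀ y ∈ U, 0 < d y
  cont : ContinuousOn d U
  hasDeriv : ∀ y ∈ U, HasDerivWithinAt h (d y) (Ioi y) y
  hasDeriv₂ : ∀ y ∈ U, HasDerivWithinAt d (e y) (Ioi y) y

/-- `N` is the quasiarithmetic mean generated by `h` on `I`. -/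
structure IsMeanOf (I : Set ℝ) (h : ℝ → ℝ) (N : MultiFun) : Prop where
  mem : ∀ n : ℕ, 0 < n → ∀ x ∈ cube I n, N n x ∈ I
  eq : ∀ n : ℕ, 0 < n → ∀ x ∈ cube I n, h (N n x) = (∑ i, h (x i)) / (n : ℝ)

lemma average_mem_image {I : Set ℝ} (hI : I.OrdConnected) {h : ℝ → ℝ} (hc : ContinuousOn h I)
    {n : ℕ} (hn : 0 < n) {x : Fin n → ℝ} (hx : x ∈ cube I n) :
    (∑ i, h (x i)) / (n : ℝ) ∈ h '' I := by
  have hconv : Convex ℝ (h '' I) := (hI.isPreconnected.image h hc).ordConnected.convex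
  have hn' : (n : ℝ) ≠ 0 := by positivity
  have := hconv.sum_mem (t := Finset.univ) (w := fun _ : Fin n => (1 / n : ℝ))
    (z := fun i => h (x i)) (fun _ _ => by positivity) (by simp [hn'])
    fun i _ => mem_image_of_mem h (hx i)
  convert this using 1
  simp only [smul_eq_mul, ← Finset.mul_sum]
  ring

lemma isMeanOf_qaMean {I : Set ℝ} (hI : I.OrdConnected) {h : ℝ → ℝ} (hc : ContinuousOn h I) :
    IsMeanOf I h (qaMean I h) where
  mem _ hn _ hx := Function.invFunOn_mem (average_mem_image hI hc hn hx)
  eq _ hn _ hx := Function.invFunOn_eq (average_mem_image hI hc hn hx)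

lemma IsMeanOf.neg {I : Set ℝ} {h : ℝ → ℝ} {N : MultiFun} (hN : IsMeanOf I h N) :
    IsMeanOf I (fun x => -h x) N where
  mem := hN.mem
  eq n hn x hx := by rw [hN.eq n hn x hx, Finset.sum_neg_distrib, neg_div]

/-- A mean in the quasiarithmetic family has an increasing generator. -/
lemma exists_increasing_generator {I : Set ℝ} (hI : I.OrdConnected) {N : MultiFun}
    (hN : N ∈ qaFamily I) :
    ∃ h : ℝ → ℝ, ContinuousOn h I ∧ StrictMonoOn h I ∧ IsMeanOf I h N := by
  obtain ⟨h, ⟨hc, hm | hm⟩, rfl⟩ := hN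
  · exact ⟨h, hc, hm, isMeanOf_qaMean hI hc⟩
  · exact ⟨fun x => -h x, hc.neg, fun x hx y hy hxy => neg_lt_neg (hm hx hy hxy),
      (isMeanOf_qaMean hI hc).neg⟩

/-- Comparison of quasiarithmetic means by `h'' / h'`. -/
lemma IsMeanOf.le_of_ratio_le {I : Set ℝ} (hI : I.OrdConnected) {h g dh eh dg eg : ℝ → ℝ}
    {M N : MultiFun} (hM : IsMeanOf I h M) (hN : IsMeanOf I g N)
    (hhc : ContinuousOn h I) (hgc : ContinuousOn g I)
    (hhm : StrictMonoOn h I) (hgm : StrictMonoOn g I)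
    (hh : RightC2 (interior I) h dh eh) (hg : RightC2 (interior I) g dg eg)
    (hle : ∀ y ∈ interior I, eh y / dh y ≤ eg y / dg y) : MultiLeOn I M N := by
  intro n hn x hx
  have hn' : (0 : ℝ) < n := by exact_mod_cast hn
  have hmI := hM.mem n hn x hx
  have hme := hM.eq n hn x hx
  have hNe := hN.eq n hn x hx
  rw [← hgm.le_iff_le hmI (hN.mem n hn x hx), hNe, le_div_iff₀ hn']
  set m := M n x
  have hsum : ∑ i, (h (x i) - h m) = 0 := by
    rw [Finset.sum_sub_distrib, hme]
    simp
    field_simp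
    ring
  -- A support line of `g` in the variable `h`; on summation its linear part vanishes by `hsum`.
  suffices H : ∃ r : ℝ, ∀ i, g m + r * (h (x i) - h m) ≤ g (x i) by
    obtain ⟨r, hr⟩ := H
    have := Finset.sum_le_sum fun i (_ : i ∈ Finset.univ) => hr i
    rw [Finset.sum_add_distrib, ← Finset.mul_sum, hsum] at this
    simp only [Finset.sum_const, Finset.card_univ, Fintype.card_fin, nsmul_eq_mul] at this
    linarith
  by_cases hmU : m ∈ interior I
  · refine ⟨dg m / dh m, fun i => ?_⟩
    -- The slope is `g'(m)/h'(m)`: the ratio `g'/h'` increases because its right derivative has the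
    -- sign of `g''/g' - h''/h'`.
    have hUo : (interior I).OrdConnected := hI.interior
    have hmono : ∀ a ∈ interior I, ∀ b ∈ interior I, a ≤ b → dg a / dh a ≤ dg b / dh b := by
      intro a ha b hb hab
      have hs : Icc a b ⊆ interior I := hUo.out ha hb
      refine le_of_rightDeriv_nonneg (T := fun y => dg y / dh y)
        (T' := fun y => (eg y * dh y - dg y * eh y) / dh y ^ 2) hab
        ((hg.cont.mono hs).div (hh.cont.mono hs) fun y hy => (hh.pos y (hs hy)).ne')
        (fun y hy => ?_) fun y hy => ?_
      · have hyU := hs (Ioo_subset_Icc_self hy)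
        exact (hg.hasDeriv₂ y hyU).div (hh.hasDeriv₂ y hyU) (hh.pos y hyU).ne'
      · have hyU := hs (Ioo_subset_Icc_self hy)
        have := hle y hyU
        rw [div_le_div_iff₀ (hh.pos y hyU) (hg.pos y hyU)] at this
        exact div_nonneg (by linarith) (sq_nonneg _)
    have hmin := isMinOn_of_rightDeriv hI (T := fun y => g y - dg m / dh m * h y)
      (T' := fun y => dg y - dg m / dh m * dh y) hmI (hgc.sub (continuousOn_const.mul hhc))
      (fun y hy => (hg.hasDeriv y hy).sub ((hh.hasDeriv y hy).const_mul _))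
      (fun y hy hmy => ?_) (fun y hy hym => ?_) (hx i)
    · linarith
    · have := hmono m hmU y hy hmy.le
      rw [le_div_iff₀ (hh.pos y hy)] at this
      linarith
    · have := hmono y hy m hmU hym.le
      rw [div_le_iff₀ (hh.pos y hy)] at this
      linarith
  -- A mean at an endpoint of `I` forces all entries to equal it, since otherwise entries would lie
  -- on both sides.
  · refine ⟨0, fun i => ?_⟩
    have hall : ∀ i, x i = m := by
      by_contra! hne
      obtain ⟨j, hj⟩ := hne
      have hj' : h (x j) - h m ≠ 0 := fun h0 => hj (hhm.injOn (hx j) hmI (by linarith))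
      obtain ⟨k, hk⟩ : ∃ k, 0 < h (x k) - h m := by
        by_contra! hcon
        exact hj' ((Finset.sum_eq_zero_iff_of_nonpos fun i _ => hcon i).1 hsum j
          (Finset.mem_univ j))
      obtain ⟨l, hl⟩ : ∃ l, h (x l) - h m < 0 := by
        by_contra! hcon
        exact hj' ((Finset.sum_eq_zero_iff_of_nonneg fun i _ => hcon i).1 hsum j
          (Finset.mem_univ j))
      have h1 : m < x k := (hhm.lt_iff_lt hmI (hx k)).1 (by linarith)
      have h2 : x l < m := (hhm.lt_iff_lt (hx l) hmI).1 (by linarith)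
      exact hmU (hI.Ioo_subset_interior (hx l) (hx k) ⟨h2, h1⟩)
    rw [hall i]
    simp

/-! ### Recovering the generator from the mean -/

/-- The tuple `(x, y, …, y)` of length `n + 1`. -/
def spike (n : ℕ) (x y : ℝ) : Fin (n + 1) → ℝ := Fin.cons x fun _ => y

lemma spike_mem_cube {I : Set ℝ} {x y : ℝ} (hx : x ∈ I) (hy : y ∈ I) (n : ℕ) :
    spike n x y ∈ cube I (n + 1) := by
  intro i
  refine Fin.cases ?_ (fun j => ?_) i
  · simpa [spike] using hx
  · simpa [spike] using hy

lemma sum_spike (h : ℝ → ℝ) (n : ℕ) (x y : ℝ) :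
    ∑ i, h (spike n x y i) = h x + n * h y := by
  simp [spike, Fin.sum_univ_succ]

lemma spike_combo (n : ℕ) (a b x₀ y₀ x₁ y₁ : ℝ) :
    a • spike n x₀ y₀ + b • spike n x₁ y₁ = spike n (a * x₀ + b * x₁) (a * y₀ + b * y₁) := by
  funext i
  refine Fin.cases ?_ (fun j => ?_) i <;> simp [spike]

/-- The single entry `x` moves the average of `h` from `h y` by `(h x - h y)/(n + 1)`; the limit is
the first-order effect under the inverse of `h`. -/
lemma tendsto_mean_spike {I : Set ℝ} (hI : I.OrdConnected) {h : ℝ → ℝ} {N : MultiFun}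
    (hN : IsMeanOf I h N) (hm : StrictMonoOn h I) {x y d : ℝ} (hx : x ∈ I) (hy : y ∈ I)
    (hyx : y < x) (hd : HasDerivWithinAt h d (Ioi y) y) (hd0 : 0 < d) :
    Tendsto (fun n : ℕ => ((n + 1 : ℕ) : ℝ) * (N (n + 1) (spike n x y) - y)) atTop
      (𝓝 ((h x - h y) / d)) := by
  set z : ℕ → ℝ := fun n => N (n + 1) (spike n x y)
  have hzI : ∀ n, z n ∈ I := fun n => hN.mem _ n.succ_pos _ (spike_mem_cube hx hy n)
  have hz : ∀ n, h (z n) = h y + (h x - h y) * (1 / ((n : ℝ) + 1)) := by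
    intro n
    have h1 : (n : ℝ) + 1 ≠ 0 := by positivity
    rw [hN.eq _ n.succ_pos _ (spike_mem_cube hx hy n), sum_spike]
    push_cast
    field_simp
    ring
  have hxy : 0 < h x - h y := sub_pos.2 (hm hy hx hyx)
  have hyz : ∀ n, y < z n := fun n => by
    rw [← hm.lt_iff_lt hy (hzI n), hz]
    have : 0 < (h x - h y) * (1 / ((n : ℝ) + 1)) := by positivity
    linarith
  have hhz : Tendsto (fun n => h (z n)) atTop (𝓝 (h y)) := by
    simp_rw [hz]
    simpa using ((tendsto_one_div_add_atTop_nhds_zero_nat (𝕜 := ℝ)).const_mul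
      (h x - h y)).const_add (h y)
  have hzy : Tendsto z atTop (𝓝[>] y) := by
    refine tendsto_nhdsWithin_iff.2 ⟨tendsto_order.2 ⟨fun a ha => ?_, fun b hb => ?_⟩,
      Eventually.of_forall hyz⟩
    · exact Eventually.of_forall fun n => ha.trans (hyz n)
    · have hw : y < min b x := lt_min hb hyx
      have hwI : min b x ∈ I := hI.out hy hx ⟨hw.le, min_le_right _ _⟩
      filter_upwards [hhz.eventually_lt_const (hm hy hwI hw)] with n hn
      exact ((hm.lt_iff_lt (hzI n) hwI).1 hn).trans_le (min_le_left _ _)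
  have hs := ((hasDerivWithinAt_iff_tendsto_slope' self_notMem_Ioi).1 hd).comp hzy
  have := (hs.inv₀ hd0.ne').const_mul (h x - h y)
  rw [← div_eq_mul_inv] at this
  refine this.congr fun n => ?_
  have h1 : (n : ℝ) + 1 ≠ 0 := by positivity
  simp only [Function.comp, slope_def_field, inv_div, hz]
  push_cast
  change _ = _ * (z n - y)
  field_simp
  rw [show h y * ((n : ℝ) + 1) + (h x - h y) - h y * (n + 1) = h x - h y by ring]
  field_simp

/-- Taylor's formula from right derivatives alone: the remainder has right derivative `o(s - y)`,
which the mean value inequality integrates. -/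
lemma tendsto_second_order {h d : ℝ → ℝ} {e y b : ℝ} (hyb : y < b)
    (hc : ContinuousOn h (Icc y b)) (hd : ∀ s ∈ Ico y b, HasDerivWithinAt h (d s) (Ioi s) s)
    (he : HasDerivWithinAt d e (Ioi y) y) :
    Tendsto (fun x => (h x - h y - (x - y) * d y) / (x - y) ^ 2) (𝓝[>] y) (𝓝 (e / 2)) := by
  rw [Metric.tendsto_nhds]
  intro η hη
  have h1 := (hasDerivWithinAt_iff_isLittleO.1 he).def (half_pos hη)
  obtain ⟨δ, hδ, hs⟩ := mem_nhdsGT_iff_exists_Ioo_subset.1 h1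
  filter_upwards [Ioo_mem_nhdsGT hyb, Ioo_mem_nhdsGT hδ] with x hx hxδ
  have hxy : 0 < x - y := sub_pos.2 hx.1
  have key := norm_image_sub_le_of_norm_deriv_right_le_segment
    (f := fun s => h s - (s - y) * d y - e * (s - y) ^ 2 / 2)
    (f' := fun s => d s - 1 * d y - e * (2 * (s - y) ^ (2 - 1) * 1) / 2) (a := y) (b := x)
    (C := η / 2 * (x - y)) ?_ ?_ ?_ x (right_mem_Icc.2 hx.1.le)
  · rw [Real.dist_eq]
    have h2 : (h x - h y - (x - y) * d y) / (x - y) ^ 2 - e / 2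
        = ((h x - (x - y) * d y - e * (x - y) ^ 2 / 2)
          - (h y - (y - y) * d y - e * (y - y) ^ 2 / 2)) / (x - y) ^ 2 := by
      field_simp
      ring
    rw [h2, abs_div, abs_of_pos (pow_pos hxy 2), div_lt_iff₀ (pow_pos hxy 2)]
    rw [Real.norm_eq_abs] at key
    nlinarith [mul_pos hη (pow_pos hxy 2)]
  · refine ContinuousOn.sub (ContinuousOn.sub (hc.mono (Icc_subset_Icc_right hx.2.le)) ?_) ?_
    · exact Continuous.continuousOn (by fun_prop)
    · exact Continuous.continuousOn (by fun_prop)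
  · intro s hs
    have h3 := (hd s ⟨hs.1, hs.2.trans hx.2⟩).Ici_of_Ioi
    have h4 : HasDerivWithinAt (fun s => s - y) 1 (Ici s) s :=
      (hasDerivWithinAt_id _ _).sub_const _
    exact (h3.sub (h4.mul_const _)).sub (((h4.pow 2).const_mul e).div_const 2)
  · intro s hs'
    rcases hs'.1.eq_or_lt with rfl | hys
    · simp only [sub_self, one_mul]
      norm_num
      positivity
    · have h5 := hs ⟨hys, hs'.2.trans hxδ.2⟩
      simp only [mem_ofPred_eq, smul_eq_mul, Real.norm_eq_abs] at h5 ⊢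
      rw [abs_of_pos (sub_pos.2 hys)] at h5
      calc _ = |d s - d y - (s - y) * e| := by congr 1; norm_num; ring
        _ ≤ η / 2 * (s - y) := h5
        _ ≤ η / 2 * (x - y) := by
          have := hs'.2
          gcongr

lemma exists_Icc_subset_right {U : Set ℝ} (hU : IsOpen U) {y : ℝ} (hy : y ∈ U) :
    ∃ b, y < b ∧ Icc y b ⊆ U := by
  obtain ⟨l, u, hyl, hlu⟩ := mem_nhds_iff_exists_Ioo_subset.1 (hU.mem_nhds hy)
  obtain ⟨b, hb1, hb2⟩ := exists_between hyl.2
  exact ⟨b, hb1, fun z hz => hlu ⟨hyl.1.trans_le hz.1, hz.2.trans_lt hb2⟩⟩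

lemma RightC2.tendsto_ratio {U : Set ℝ} (hU : IsOpen U) {h d e : ℝ → ℝ} (hh : RightC2 U h d e)
    (hc : ContinuousOn h U) {y : ℝ} (hy : y ∈ U) :
    Tendsto (fun x => ((h x - h y) / d y - (x - y)) / (x - y) ^ 2) (𝓝[>] y)
      (𝓝 (e y / d y / 2)) := by
  obtain ⟨b, hyb, hb⟩ := exists_Icc_subset_right hU hy
  have := (tendsto_second_order hyb (hc.mono hb)
    (fun s hs => hh.hasDeriv s (hb (Ico_subset_Icc_self hs))) (hh.hasDeriv₂ y hy)).div_const (d y)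
  rw [div_right_comm] at this
  refine this.congr fun x => ?_
  have := (hh.pos y hy).ne'
  field_simp

/-- Comparable quasiarithmetic means have comparable ratios `h'' / h'`. -/
lemma IsMeanOf.ratio_le_of_le {I : Set ℝ} (hI : I.OrdConnected) {h g dh eh dg eg : ℝ → ℝ}
    {M N : MultiFun} (hM : IsMeanOf I h M) (hN : IsMeanOf I g N)
    (hhc : ContinuousOn h I) (hgc : ContinuousOn g I)
    (hhm : StrictMonoOn h I) (hgm : StrictMonoOn g I)
    (hh : RightC2 (interior I) h dh eh) (hg : RightC2 (interior I) g dg eg)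
    (hle : MultiLeOn I M N) {y : ℝ} (hy : y ∈ interior I) : eh y / dh y ≤ eg y / dg y := by
  have h1 := hh.tendsto_ratio isOpen_interior (hhc.mono interior_subset) hy
  have h2 := hg.tendsto_ratio isOpen_interior (hgc.mono interior_subset) hy
  suffices e : eh y / dh y / 2 ≤ eg y / dg y / 2 by linarith
  -- The order of the means passes to `(h x - h y)/h'(y)` through the spike limits; the ratios are
  -- then compared as `x` decreases to `y`.
  refine le_of_tendsto_of_tendsto h1 h2 ?_
  obtain ⟨b, hyb, hb⟩ := exists_Icc_subset_right isOpen_interior hy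
  filter_upwards [Ioo_mem_nhdsGT hyb] with x hx
  have hxI : x ∈ I := interior_subset (hb (Ioo_subset_Icc_self hx))
  have hyI := interior_subset hy
  have h3 := tendsto_mean_spike hI hM hhm hxI hyI hx.1 (hh.hasDeriv y hy) (hh.pos y hy)
  have h4 := tendsto_mean_spike hI hN hgm hxI hyI hx.1 (hg.hasDeriv y hy) (hg.pos y hy)
  have h5 := le_of_tendsto_of_tendsto' h3 h4 fun n =>
    mul_le_mul_of_nonneg_left (sub_le_sub_right
      (hle (n + 1) n.succ_pos _ (spike_mem_cube hxI hyI n)) y) (Nat.cast_nonneg _)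
  gcongr

/-! ### Necessary conditions for convexity -/

lemma IsMeanOf.continuousOn {I : Set ℝ} (hI : I.OrdConnected) {h : ℝ → ℝ} {N : MultiFun}
    (hN : IsMeanOf I h N) (hc : ContinuousOn h I) (hm : StrictMonoOn h I) {n : ℕ} (hn : 0 < n) :
    ContinuousOn (N n) (cube I n) := by
  intro x hx
  have havg : Tendsto (fun z : Fin n → ℝ => (∑ i, h (z i)) / (n : ℝ)) (𝓝[cube I n] x)
      (𝓝 (h (N n x))) := by
    rw [hN.eq n hn x hx]
    refine Tendsto.div_const (tendsto_finsetSum _ fun i _ => ?_) _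
    exact (hc (x i) (hx i)).tendsto.comp
      (tendsto_nhdsWithin_iff.2 ⟨((continuous_apply i).tendsto x).mono_left nhdsWithin_le_nhds,
        eventually_mem_nhdsWithin.mono fun z hz => hz i⟩)
  have hmem : ∀ᶠ z in 𝓝[cube I n] x, z ∈ cube I n := eventually_mem_nhdsWithin
  refine tendsto_order.2 ⟨fun a ha => ?_, fun b hb => ?_⟩
  · by_cases haI : a ∈ I
    · filter_upwards [havg.eventually_const_lt (hm haI (hN.mem n hn x hx) ha), hmem] with z hz hzc
      rw [← hN.eq n hn z hzc] at hz
      exact (hm.lt_iff_lt haI (hN.mem n hn z hzc)).1 hz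
    · filter_upwards [hmem] with z hzc
      by_contra! hcon
      exact haI (hI.out (hN.mem n hn z hzc) (hN.mem n hn x hx) ⟨hcon, ha.le⟩)
  · by_cases hbI : b ∈ I
    · filter_upwards [havg.eventually_lt_const (hm (hN.mem n hn x hx) hbI hb), hmem] with z hz hzc
      rw [← hN.eq n hn z hzc] at hz
      exact (hm.lt_iff_lt (hN.mem n hn z hzc) hbI).1 hz
    · filter_upwards [hmem] with z hzc
      by_contra! hcon
      exact hbI (hI.out (hN.mem n hn x hx) (hN.mem n hn z hzc) ⟨hb.le, hcon⟩)

lemma convex_cube {I : Set ℝ} (hI : I.OrdConnected) (n : ℕ) : Convex ℝ (cube I n) :=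
  fun _ hx _ hy _ _ ha hb hab i => hI.convex (hx i) (hy i) ha hb hab

lemma IsMeanOf.convexOn {I : Set ℝ} (hI : I.OrdConnected) {h : ℝ → ℝ} {N : MultiFun}
    (hN : IsMeanOf I h N) (hc : ContinuousOn h I) (hm : StrictMonoOn h I)
    (hJ : MultiJensenConvexOn I N) {n : ℕ} (hn : 0 < n) : ConvexOn ℝ (cube I n) (N n) :=
  (hJ n hn).convexOn (convex_cube hI n) (hN.continuousOn hI hc hm hn)

/-- The generator of a Jensen convex quasiarithmetic mean is convex if it is increasing. -/
lemma IsMeanOf.generator_convexOn {I : Set ℝ} (hI : I.OrdConnected) {h : ℝ → ℝ} {N : MultiFun}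
    (hN : IsMeanOf I h N) (hc : ContinuousOn h I) (hm : StrictMonoOn h I)
    (hJ : MultiJensenConvexOn I N) : ConvexOn ℝ I h := by
  refine JensenConvexOn.convexOn hI.convex hc fun x hx y hy => ?_
  have hz : midpoint ℝ x y ∈ I := hI.convex.midpoint_mem hx hy
  have h1 : ![x, y] ∈ cube I 2 := by intro i; fin_cases i <;> simpa
  have h2 : ![y, x] ∈ cube I 2 := by intro i; fin_cases i <;> simpa
  have h3 : (fun _ => midpoint ℝ x y) ∈ cube I 2 := fun _ => hz
  -- The two orderings of a pair have equal means, and their midpoint is a constant pair.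
  have hmid : midpoint ℝ ![x, y] ![y, x] = fun _ => midpoint ℝ x y := by
    funext i
    fin_cases i <;> simp [midpoint_eq_smul_add, add_comm]
  have hj := hJ 2 two_pos _ h1 _ h2
  rw [hmid] at hj
  have e3 : N 2 (fun _ => midpoint ℝ x y) = midpoint ℝ x y := by
    refine hm.injOn (hN.mem 2 two_pos _ h3) hz ?_
    rw [hN.eq 2 two_pos _ h3]
    simp
  have e1 := hN.eq 2 two_pos _ h1
  have e2 := hN.eq 2 two_pos _ h2
  simp only [Fin.sum_univ_two, Matrix.cons_val_zero, Matrix.cons_val_one] at e1 e2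
  have e4 : N 2 ![y, x] = N 2 ![x, y] := by
    refine hm.injOn (hN.mem 2 two_pos _ h2) (hN.mem 2 two_pos _ h1) ?_
    rw [e1, e2, add_comm]
  rw [e3, e4] at hj
  have := hm.monotoneOn hz (hN.mem 2 two_pos _ h1) (by linarith)
  rw [e1] at this
  exact_mod_cast this

/-- Here `(y, w) ↦ w² q(y)` is convex for `w > 0`. At a zero of `q` an arbitrarily large `w` is
free, which forces `q = 0` everywhere; without zeros, the choice `w = 1/q(y)` gives concavity of
`1/q`. -/
lemma ratio_dichotomy {U : Set ℝ} (hU : IsOpen U) (hUc : Convex ℝ U) {q : ℝ → ℝ}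
    (hq0 : ∀ y ∈ U, 0 ≤ q y)
    (hq : ∀ y₀ ∈ U, ∀ y₁ ∈ U, ∀ w₀ w₁ a b : ℝ, 0 < w₀ → 0 < w₁ → 0 ≤ a → 0 ≤ b → a + b = 1 →
      (a * w₀ + b * w₁) ^ 2 * q (a * y₀ + b * y₁) ≤ a * (w₀ ^ 2 * q y₀) + b * (w₁ ^ 2 * q y₁)) :
    (∀ y ∈ U, q y = 0) ∨ ((∀ y ∈ U, 0 < q y) ∧ ConcaveOn ℝ U fun y => (q y)⁻¹) := by
  by_cases hz : ∃ y₀ ∈ U, q y₀ = 0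
  · left
    obtain ⟨y₀, hy₀, hqy₀⟩ := hz
    intro y₁ hy₁
    by_contra hne
    have hpos : 0 < q y₁ := lt_of_le_of_ne (hq0 y₁ hy₁) (Ne.symm hne)
    -- The segment is prolonged beyond `y₁`, making `y₁` a convex combination of `y₀` and `y₂`.
    obtain ⟨δ, hδU, hδ⟩ : ∃ δ, y₁ + δ * (y₁ - y₀) ∈ U ∧ 0 < δ := by
      have hcont : Tendsto (fun δ : ℝ => y₁ + δ * (y₁ - y₀)) (𝓝[>] 0) (𝓝 y₁) := by
        have : Continuous fun δ : ℝ => y₁ + δ * (y₁ - y₀) := by fun_prop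
        simpa using (this.tendsto 0).mono_left nhdsWithin_le_nhds
      exact ((hcont.eventually (hU.mem_nhds hy₁)).and eventually_mem_nhdsWithin).exists
    set y₂ := y₁ + δ * (y₁ - y₀)
    set a := δ / (1 + δ)
    set b := 1 / (1 + δ)
    have ha : 0 < a := by positivity
    have hb : 0 < b := by positivity
    have hab : a + b = 1 := by simp only [a, b]; field_simp; ring
    have hy : a * y₀ + b * y₂ = y₁ := by simp only [a, b, y₂]; field_simp; ring
    have hc0 : 0 ≤ b * q y₂ / q y₁ := by have := hq0 y₂ hδU; positivity
    -- With `c = b * q y₂ / q y₁`, this weight turns the inequality into `(1 + c + b)² ≤ c` after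
    -- division by `q y₁`, which is impossible.
    have key := hq y₀ hy₀ y₂ hδU ((1 + b * q y₂ / q y₁) / a) 1 a b (by positivity) one_pos ha.le
      hb.le hab
    rw [hy, hqy₀, mul_div_cancel₀ _ ha.ne'] at key
    have hc1 : b * q y₂ / q y₁ * q y₁ = b * q y₂ := div_mul_cancel₀ _ hpos.ne'
    set c := b * q y₂ / q y₁
    have : c < (1 + c + b * 1) ^ 2 := by nlinarith
    nlinarith [mul_lt_mul_of_pos_right this hpos]
  · right
    push Not at hz
    have hpos : ∀ y ∈ U, 0 < q y := fun y hy => lt_of_le_of_ne (hq0 y hy) (Ne.symm (hz y hy))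
    refine ⟨hpos, hUc, fun y₀ hy₀ y₁ hy₁ a b ha hb hab => ?_⟩
    have h0 := hpos y₀ hy₀
    have h1 := hpos y₁ hy₁
    have h2 := hpos _ (hUc hy₀ hy₁ ha hb hab)
    have key := hq y₀ hy₀ y₁ hy₁ (q y₀)⁻¹ (q y₁)⁻¹ a b (inv_pos.2 h0) (inv_pos.2 h1) ha hb hab
    simp only [smul_eq_mul] at h2 ⊢
    have e0 : (q y₀)⁻¹ ^ 2 * q y₀ = (q y₀)⁻¹ := by field_simp
    have e1 : (q y₁)⁻¹ ^ 2 * q y₁ = (q y₁)⁻¹ := by field_simp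
    rw [e0, e1] at key
    have hk : 0 < a * (q y₀)⁻¹ + b * (q y₁)⁻¹ := by
      rcases ha.eq_or_lt with rfl | ha'
      · obtain rfl : b = 1 := by linarith
        simpa using h1
      · have := inv_pos.2 h0
        have := inv_pos.2 h1
        positivity
    rw [le_inv_comm₀ hk h2, ← one_div, le_div_iff₀ hk]
    nlinarith

/-- Structure of Jensen convex quasiarithmetic means. -/
theorem IsMeanOf.structure_of_jensenConvex {I : Set ℝ} (hI : I.OrdConnected) {h : ℝ → ℝ}
    {N : MultiFun} (hN : IsMeanOf I h N) (hc : ContinuousOn h I) (hm : StrictMonoOn h I)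
    (hJ : MultiJensenConvexOn I N) :
    ∃ d e : ℝ → ℝ, RightC2 (interior I) h d e ∧
      ((∀ y ∈ interior I, e y = 0) ∨
        ((∀ y ∈ interior I, 0 < e y) ∧ ConcaveOn ℝ (interior I) fun y => d y / e y)) := by
  have hconv := hN.generator_convexOn hI hc hm hJ
  have hUI : interior I ⊆ I := interior_subset
  have hUo : IsOpen (interior I) := isOpen_interior
  have hUc : Convex ℝ (interior I) := hI.convex.interior
  set U := interior I
  set d : ℝ → ℝ := fun y => derivWithin h (Ioi y) y
  have hd : ∀ y ∈ U, HasDerivWithinAt h (d y) (Ioi y) y := fun y hy =>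
    hconv.hasDerivWithinAt_rightDeriv_of_mem_interior hy
  have hdpos : ∀ y ∈ U, 0 < d y := by
    intro y hy
    obtain ⟨l, u, hyl, hlu⟩ := mem_nhds_iff_exists_Ioo_subset.1 (hUo.mem_nhds hy)
    obtain ⟨a, ha1, ha2⟩ := exists_between hyl.1
    have haU : a ∈ U := hlu ⟨ha1, ha2.trans hyl.2⟩
    have h1 := hconv.slope_le_leftDeriv_of_mem_interior (hUI haU) hy ha2
    have h2 := hconv.leftDeriv_le_rightDeriv_of_mem_interior hy
    have h3 : 0 < slope h a y := by
      rw [slope_def_field]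
      exact div_pos (sub_pos.2 (hm (hUI haU) (hUI hy) ha2)) (sub_pos.2 ha2)
    exact h3.trans_le (h1.trans h2)
  -- Joint convexity in `(x, y)`, as a limit of the convexity of `N` along spikes.
  have hE : ∀ x₀ ∈ U, ∀ y₀ ∈ U, ∀ x₁ ∈ U, ∀ y₁ ∈ U, y₀ < x₀ → y₁ < x₁ → ∀ a b : ℝ, 0 ≤ a → 0 ≤ b →
      a + b = 1 →
      (h (a * x₀ + b * x₁) - h (a * y₀ + b * y₁)) / d (a * y₀ + b * y₁)
        ≤ a * ((h x₀ - h y₀) / d y₀) + b * ((h x₁ - h y₁) / d y₁) := by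
    intro x₀ hx₀ y₀ hy₀ x₁ hx₁ y₁ hy₁ h0 h1 a b ha hb hab
    have hx : a * x₀ + b * x₁ ∈ U := hUc hx₀ hx₁ ha hb hab
    have hy : a * y₀ + b * y₁ ∈ U := hUc hy₀ hy₁ ha hb hab
    have hyx : a * y₀ + b * y₁ < a * x₀ + b * x₁ := by
      rcases ha.eq_or_lt with rfl | ha'
      · obtain rfl : b = 1 := by linarith
        simpa using h1
      · nlinarith [mul_lt_mul_of_pos_left h0 ha', mul_le_mul_of_nonneg_left h1.le hb]
    have t0 := tendsto_mean_spike hI hN hm (hUI hx₀) (hUI hy₀) h0 (hd _ hy₀) (hdpos _ hy₀)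
    have t1 := tendsto_mean_spike hI hN hm (hUI hx₁) (hUI hy₁) h1 (hd _ hy₁) (hdpos _ hy₁)
    have t := tendsto_mean_spike hI hN hm (hUI hx) (hUI hy) hyx (hd _ hy) (hdpos _ hy)
    refine le_of_tendsto_of_tendsto' t ((t0.const_mul a).add (t1.const_mul b)) fun n => ?_
    have := (hN.convexOn hI hc hm hJ n.succ_pos).2 (spike_mem_cube (hUI hx₀) (hUI hy₀) n)
      (spike_mem_cube (hUI hx₁) (hUI hy₁) n) ha hb hab
    rw [spike_combo] at this
    simp only [smul_eq_mul] at this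
    have hn : (0 : ℝ) ≤ ((n + 1 : ℕ) : ℝ) := Nat.cast_nonneg _
    have e1 := mul_le_mul_of_nonneg_left this hn
    obtain rfl : a = 1 - b := by linarith
    linarith
  -- With `x` frozen, convexity makes this quotient continuous and right differentiable; solving for
  -- `d` transfers both properties to `d`.
  have hR : ∀ x ∈ U, ConvexOn ℝ (U ∩ Iio x) fun y => (h x - h y) / d y := by
    refine fun x hx => ⟨hUc.inter (convex_Iio x), fun y₀ hy₀ y₁ hy₁ a b ha hb hab => ?_⟩
    have := hE x hx y₀ hy₀.1 x hx y₁ hy₁.1 hy₀.2 hy₁.2 a b ha hb hab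
    rw [← add_mul, hab, one_mul] at this
    exact this
  have hRpos : ∀ x ∈ U, ∀ y ∈ U, y < x → 0 < (h x - h y) / d y := fun x hx y hy hyx =>
    div_pos (sub_pos.2 (hm (hUI hy) (hUI hx) hyx)) (hdpos y hy)
  have hdR : ∀ x ∈ U, ∀ y ∈ U, y < x → d y = (h x - h y) / ((h x - h y) / d y) := by
    intro x hx y hy hyx
    have h1 := (hdpos y hy).ne'
    have h2 : h x - h y ≠ 0 := (sub_pos.2 (hm (hUI hy) (hUI hx) hyx)).ne'
    field_simp
  have hUx : ∀ x, IsOpen (U ∩ Iio x) := fun x => hUo.inter isOpen_Iio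
  have hdc : ContinuousOn d U := by
    intro y hy
    obtain ⟨x, hyx, hx⟩ := exists_Icc_subset_right hUo hy
    have hxU := hx (right_mem_Icc.2 hyx.le)
    have hnh : U ∩ Iio x ∈ 𝓝 y := (hUx x).mem_nhds ⟨hy, hyx⟩
    have h1 : ContinuousAt (fun y => (h x - h y) / d y) y :=
      ((hR x hxU).continuousOn (hUx x)).continuousAt hnh
    have h2 : ContinuousAt (fun y => h x - h y) y :=
      continuousAt_const.sub ((hc.mono hUI).continuousAt (hUo.mem_nhds hy))
    refine ContinuousAt.continuousWithinAt ((h2.div h1 (hRpos x hxU y hy hyx).ne').congr ?_)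
    filter_upwards [hnh] with z hz
    exact (hdR x hxU z hz.1 hz.2).symm
  have hde : ∀ y ∈ U, ∃ e, HasDerivWithinAt d e (Ioi y) y := by
    intro y hy
    obtain ⟨x, hyx, hx⟩ := exists_Icc_subset_right hUo hy
    have hxU := hx (right_mem_Icc.2 hyx.le)
    have h1 := (hR x hxU).hasDerivWithinAt_rightDeriv_of_mem_interior
      (by rw [(hUx x).interior_eq]; exact ⟨hy, hyx⟩)
    have h2 := ((hd y hy).const_sub (h x)).div h1 (hRpos x hxU y hy hyx).ne'
    refine ⟨_, h2.congr_of_eventuallyEq ?_ (hdR x hxU y hy hyx)⟩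
    filter_upwards [nhdsWithin_le_nhds ((hUx x).mem_nhds ⟨hy, hyx⟩)] with z hz
    exact hdR x hxU z hz.1 hz.2
  have hde' : ∀ y ∈ U, HasDerivWithinAt d (derivWithin d (Ioi y) y) (Ioi y) y := fun y hy =>
    (hde y hy).choose_spec.differentiableWithinAt.hasDerivWithinAt
  set e : ℝ → ℝ := fun y => derivWithin d (Ioi y) y
  have hC2 : RightC2 U h d e := ⟨hdpos, hdc, hd, hde'⟩
  have hlim := fun y (hy : y ∈ U) => hC2.tendsto_ratio hUo (hc.mono hUI) hy
  have hq0 : ∀ y ∈ U, 0 ≤ e y / d y := by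
    intro y hy
    suffices 0 ≤ e y / d y / 2 by linarith
    obtain ⟨b, hyb, hb⟩ := exists_Icc_subset_right hUo hy
    refine ge_of_tendsto (hlim y hy) ?_
    filter_upwards [Ioo_mem_nhdsGT hyb] with x hx
    have h1 := hconv.rightDeriv_le_slope_of_mem_interior hy (hUI (hb (Ioo_subset_Icc_self hx))) hx.1
    rw [slope_def_field, le_div_iff₀ (sub_pos.2 hx.1)] at h1
    refine div_nonneg (sub_nonneg.2 ?_) (sq_nonneg _)
    rw [le_div_iff₀ (hdpos y hy)]
    linarith
  have hlimw : ∀ y ∈ U, ∀ w : ℝ, 0 < w → Tendsto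
      (fun ε : ℝ => ((h (y + ε * w) - h y) / d y - ε * w) / ε ^ 2) (𝓝[>] 0)
      (𝓝 (w ^ 2 * (e y / d y) / 2)) := by
    intro y hy w hw
    have h1 : Tendsto (fun ε : ℝ => y + ε * w) (𝓝[>] 0) (𝓝[>] y) := by
      refine tendsto_nhdsWithin_iff.2 ⟨?_, ?_⟩
      · have : Continuous fun ε : ℝ => y + ε * w := by fun_prop
        simpa using (this.tendsto 0).mono_left nhdsWithin_le_nhds
      · filter_upwards [self_mem_nhdsWithin] with ε hε
        exact lt_add_of_pos_right _ (mul_pos hε hw)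
    have h2 := ((hlim y hy).comp h1).const_mul (w ^ 2)
    rw [← mul_div_assoc] at h2
    refine h2.congr' ?_
    filter_upwards [self_mem_nhdsWithin] with ε hε
    have hε' : ε ≠ 0 := (mem_Ioi.1 hε).ne'
    simp only [Function.comp, add_sub_cancel_left]
    field_simp
  -- `hE` is used at `x = y + ε w`; the terms `ε w` combine affinely and cancel, and division by
  -- `ε²` leaves the second-order terms.
  have hq := ratio_dichotomy hUo hUc hq0 (by
    intro y₀ hy₀ y₁ hy₁ w₀ w₁ a b hw₀ hw₁ ha hb hab
    have hy : a * y₀ + b * y₁ ∈ U := hUc hy₀ hy₁ ha hb hab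
    have hw : 0 < a * w₀ + b * w₁ := by
      rcases ha.eq_or_lt with rfl | ha'
      · obtain rfl : b = 1 := by linarith
        simpa using hw₁
      · positivity
    have hmem : ∀ y ∈ U, ∀ w : ℝ, ∀ᶠ ε in 𝓝[>] (0 : ℝ), y + ε * w ∈ U := by
      intro y hy w
      have : Continuous fun ε : ℝ => y + ε * w := by fun_prop
      exact (this.tendsto 0).mono_left nhdsWithin_le_nhds
        (by simpa using hUo.mem_nhds hy)
    suffices (a * w₀ + b * w₁) ^ 2 * (e (a * y₀ + b * y₁) / d (a * y₀ + b * y₁)) / 2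
        ≤ a * (w₀ ^ 2 * (e y₀ / d y₀) / 2) + b * (w₁ ^ 2 * (e y₁ / d y₁) / 2) by linarith
    refine le_of_tendsto_of_tendsto (hlimw _ hy _ hw)
      (((hlimw y₀ hy₀ w₀ hw₀).const_mul a).add ((hlimw y₁ hy₁ w₁ hw₁).const_mul b)) ?_
    filter_upwards [self_mem_nhdsWithin, hmem y₀ hy₀ w₀, hmem y₁ hy₁ w₁] with ε hε h0 h1
    have hε' : 0 < ε := hε
    have key := hE _ h0 y₀ hy₀ _ h1 y₁ hy₁ (lt_add_of_pos_right _ (mul_pos hε' hw₀))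
      (lt_add_of_pos_right _ (mul_pos hε' hw₁)) a b ha hb hab
    rw [show a * (y₀ + ε * w₀) + b * (y₁ + ε * w₁)
      = a * y₀ + b * y₁ + ε * (a * w₀ + b * w₁) by ring] at key
    rw [← mul_div_assoc, ← mul_div_assoc, ← add_div]
    gcongr
    linarith)
  refine ⟨d, e, hC2, hq.imp (fun h0 y hy => ?_) fun h1 => ⟨fun y hy => ?_, ?_⟩⟩
  · exact (div_eq_zero_iff.1 (h0 y hy)).resolve_right (hdpos y hy).ne'
  · exact (div_pos_iff_of_pos_right (hdpos y hy)).1 (h1.1 y hy)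
  · simpa only [inv_div] using h1.2

/-! ### Sufficient condition for convexity -/

/-- `dslope` stays meaningful where `F s = F t`, so the difference quotient of `B` can be divided by
it. -/
lemma hasDerivAt_of_comp_eventuallyEq {F B g : ℝ → ℝ} {t B' g' : ℝ} (hF : ContinuousAt F t)
    (hg : HasDerivAt g g' (F t)) (hg' : g' ≠ 0) (hB : HasDerivAt B B' t)
    (h : ∀ᶠ s in 𝓝 t, g (F s) = B s) : HasDerivAt F (B' / g') t := by
  have hφ : Tendsto (fun s => dslope g (F t) (F s)) (𝓝[≠] t) (𝓝 g') := by
    have h1 := (continuousAt_dslope_same.2 hg.differentiableAt).comp hF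
    have h2 : Tendsto (fun s => dslope g (F t) (F s)) (𝓝 t) (𝓝 (dslope g (F t) (F t))) := h1
    rw [dslope_same, hg.deriv] at h2
    exact h2.mono_left nhdsWithin_le_nhds
  rw [hasDerivAt_iff_tendsto_slope]
  refine ((hasDerivAt_iff_tendsto_slope.1 hB).div hφ hg').congr' ?_
  filter_upwards [hφ.eventually_ne hg', nhdsWithin_le_nhds h] with s hs hBs
  have h3 := sub_smul_dslope g (F t) (F s)
  rw [smul_eq_mul, hBs, h.self_of_nhds] at h3
  simp only [Pi.div_apply, slope_def_field, ← h3]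
  field_simp

/-- Viewed as a function of `g`, the quantity `G²/G₂` has right derivative `1 - r`, where `r` is the
increasing right derivative of `-G/G₂`. It is thus concave in `g`, and `c = 1 - r y` is its slope at
`y`. -/
lemma _root_.ConcaveOn.mul_le_tangent {U : Set ℝ} (hU : IsOpen U) {g G G₂ : ℝ → ℝ}
    (hg : ∀ x ∈ U, HasDerivAt g (G x) x) (hG : ∀ x ∈ U, HasDerivAt G (G₂ x) x)
    (hpos : ∀ x ∈ U, 0 < G x) (hpos₂ : ∀ x ∈ U, 0 < G₂ x)
    (hk : ConcaveOn ℝ U fun x => G x / G₂ x) {y : ℝ} (hy : y ∈ U) :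
    ∃ c : ℝ, ∀ x ∈ U, G x ^ 2 / G₂ x ≤ G y ^ 2 / G₂ y + c * (g x - g y) := by
  have hκ : ConvexOn ℝ U fun x => -(G x / G₂ x) := hk.neg
  set κ : ℝ → ℝ := fun x => -(G x / G₂ x)
  set r : ℝ → ℝ := fun x => derivWithin κ (Ioi x) x
  have hr : ∀ x ∈ U, HasDerivWithinAt κ (r x) (Ioi x) x := fun x hx =>
    hκ.hasDerivWithinAt_rightDeriv_of_mem_interior (by rwa [hU.interior_eq])
  have hmono : MonotoneOn r U := by
    have := hκ.monotoneOn_rightDeriv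
    rwa [hU.interior_eq] at this
  refine ⟨1 - r y, fun x hx => ?_⟩
  have hGκ : ∀ x ∈ U, G x * κ x = -(G x ^ 2 / G₂ x) := fun x hx => by
    simp only [κ]
    ring
  have hint := hU.interior_eq
  have key := isMinOn_of_rightDeriv (I := U) hk.1.ordConnected
    (T := fun x => (1 - r y) * g x + G x * κ x)
    (T' := fun x => (1 - r y) * G x + (G₂ x * κ x + G x * r x)) hy ?_ ?_ ?_ ?_ hx
  · simp only [hGκ x hx, hGκ y hy] at key
    linarith
  · refine ContinuousOn.add (continuousOn_const.mul fun x hx => ?_) (ContinuousOn.mul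
      (fun x hx => ?_) (hκ.continuousOn hU))
    · exact (hg x hx).continuousAt.continuousWithinAt
    · exact (hG x hx).continuousAt.continuousWithinAt
  · rw [hint]
    intro x hx
    exact ((hg x hx).hasDerivWithinAt.const_mul _).add
      ((hG x hx).hasDerivWithinAt.mul (hr x hx))
  · rw [hint]
    intro x hx hyx
    have h1 := hmono hy hx hyx.le
    have h2 : G₂ x * κ x = -G x := by
      have := (hpos₂ x hx).ne'
      simp only [κ]
      field_simp
    rw [h2]
    nlinarith [mul_le_mul_of_nonneg_left h1 (hpos x hx).le]
  · rw [hint]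
    intro x hx hyx
    have h1 := hmono hx hy hyx.le
    have h2 : G₂ x * κ x = -G x := by
      have := (hpos₂ x hx).ne'
      simp only [κ]
      field_simp
    rw [h2]
    nlinarith [mul_le_mul_of_nonneg_left h1 (hpos x hx).le]

lemma IsMeanOf.mono {I U : Set ℝ} (hUI : U ⊆ I) (hU : U.OrdConnected) {h : ℝ → ℝ} {N : MultiFun}
    (hN : IsMeanOf I h N) (hc : ContinuousOn h I) (hm : StrictMonoOn h I) : IsMeanOf U h N where
  mem n hn x hx := by
    have hxI : x ∈ cube I n := fun i => hUI (hx i)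
    obtain ⟨m, hmU, hme⟩ := average_mem_image hU (hc.mono hUI) hn hx
    rw [← hN.eq n hn x hxI] at hme
    rwa [← hm.injOn (hUI hmU) (hN.mem n hn x hxI) hme]
  eq n hn x hx := hN.eq n hn x fun i => hUI (hx i)

/-- Differentiating `g (F t) = B t` twice along a segment, `F'' ≥ 0` amounts to `B₁² ≤ (G²/G₂)(F) *
B₂`. Cauchy–Schwarz bounds `B₁²` by the average of `G²/G₂` times `B₂`, and concavity of `G²/G₂` in
`g` bounds that average by its value at `F`. -/
lemma IsMeanOf.jensenConvexOn_of_isOpen {U : Set ℝ} (hU : IsOpen U) {g G G₂ : ℝ → ℝ}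
    {N : MultiFun} (hN : IsMeanOf U g N) (hm : StrictMonoOn g U)
    (hg : ∀ x ∈ U, HasDerivAt g (G x) x) (hG : ∀ x ∈ U, HasDerivAt G (G₂ x) x)
    (hpos : ∀ x ∈ U, 0 < G x) (hpos₂ : ∀ x ∈ U, 0 < G₂ x)
    (hk : ConcaveOn ℝ U fun x => G x / G₂ x) : MultiJensenConvexOn U N := by
  intro n hn x hx y hy
  have hUord := hk.1.ordConnected
  have hgc : ContinuousOn g U := fun x hx => (hg x hx).continuousAt.continuousWithinAt
  have hn' : (0 : ℝ) < n := by exact_mod_cast hn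
  set X : ℝ → Fin n → ℝ := fun t => (1 - t) • x + t • y
  have hX : ∀ t ∈ Icc (0 : ℝ) 1, X t ∈ cube U n := fun t ht =>
    convex_cube hUord n hx hy (by linarith [ht.2]) ht.1 (by ring)
  have hXc : Continuous X := by simp only [X]; fun_prop
  have hNc := hN.continuousOn hUord hgc hm hn
  have hFc : ContinuousOn (fun t => N n (X t)) (Icc 0 1) := hNc.comp hXc.continuousOn hX
  set F : ℝ → ℝ := fun t => N n (X t)
  have hFU : ∀ t ∈ Icc (0 : ℝ) 1, F t ∈ U := fun t ht => hN.mem n hn _ (hX t ht)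
  have hFB : ∀ t ∈ Icc (0 : ℝ) 1, g (F t) = (∑ i, g (X t i)) / (n : ℝ) := fun t ht =>
    hN.eq n hn _ (hX t ht)
  set v : Fin n → ℝ := fun i => y i - x i
  have hXd : ∀ i t, HasDerivAt (fun t => X t i) (v i) t := by
    intro i t
    have h1 : HasDerivAt (fun t : ℝ => x i + t * (y i - x i)) (1 * (y i - x i)) t :=
      ((hasDerivAt_id t).mul_const _).const_add _
    rw [one_mul] at h1
    refine h1.congr_of_eventuallyEq (Eventually.of_forall fun s => ?_)
    simp only [X, Pi.add_apply, Pi.smul_apply, smul_eq_mul]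
    ring
  set B₁ : ℝ → ℝ := fun t => (∑ i, G (X t i) * v i) / (n : ℝ)
  set B₂ : ℝ → ℝ := fun t => (∑ i, G₂ (X t i) * v i * v i) / (n : ℝ)
  have hB₁ : ∀ t ∈ Icc (0 : ℝ) 1, HasDerivAt (fun t => (∑ i, g (X t i)) / (n : ℝ)) (B₁ t) t :=
    fun t ht => (HasDerivAt.fun_sum fun i _ =>
      (hg _ (hX t ht i)).comp t (hXd i t)).div_const _
  have hB₂ : ∀ t ∈ Icc (0 : ℝ) 1, HasDerivAt B₁ (B₂ t) t :=
    fun t ht => (HasDerivAt.fun_sum fun i _ =>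
      ((hG _ (hX t ht i)).comp t (hXd i t)).mul_const (v i)).div_const _
  have hF₁ : ∀ t ∈ Ioo (0 : ℝ) 1, HasDerivAt F (B₁ t / G (F t)) t := by
    intro t ht
    have htI := Ioo_subset_Icc_self ht
    have hnh := Icc_mem_nhds ht.1 ht.2
    refine hasDerivAt_of_comp_eventuallyEq (hFc.continuousAt hnh) (hg _ (hFU t htI))
      (hpos _ (hFU t htI)).ne' (hB₁ t htI) ?_
    filter_upwards [hnh] with s hs
    exact hFB s hs
  have hF₂ : ∀ t ∈ Ioo (0 : ℝ) 1, HasDerivAt (fun t => B₁ t / G (F t))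
      ((B₂ t * G (F t) - B₁ t * (G₂ (F t) * (B₁ t / G (F t)))) / G (F t) ^ 2) t := by
    intro t ht
    have htI := Ioo_subset_Icc_self ht
    exact (hB₂ t htI).div ((hG _ (hFU t htI)).comp t (hF₁ t ht)) (hpos _ (hFU t htI)).ne'
  have hconv : ConvexOn ℝ (Icc (0 : ℝ) 1) F := by
    refine convexOn_of_hasDerivWithinAt2_nonneg (convex_Icc 0 1) hFc
      (f' := fun t => B₁ t / G (F t))
      (f'' := fun t => (B₂ t * G (F t) - B₁ t * (G₂ (F t) * (B₁ t / G (F t)))) / G (F t) ^ 2)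
      ?_ ?_ ?_
    · rw [interior_Icc]
      exact fun t ht => (hF₁ t ht).hasDerivWithinAt
    · rw [interior_Icc]
      exact fun t ht => (hF₂ t ht).hasDerivWithinAt
    · rw [interior_Icc]
      intro t ht
      have htI := Ioo_subset_Icc_self ht
      have hFt := hFU t htI
      have hGF := hpos _ hFt
      have hGF₂ := hpos₂ _ hFt
      refine div_nonneg ?_ (sq_nonneg _)
      obtain ⟨c, hc⟩ := hk.mul_le_tangent hU hg hG hpos hpos₂ hFt
      have hA : (∑ i, G (X t i) ^ 2 / G₂ (X t i)) ≤ n * (G (F t) ^ 2 / G₂ (F t)) := by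
        have h1 := Finset.sum_le_sum fun i (_ : i ∈ Finset.univ) => hc _ (hX t htI i)
        rw [Finset.sum_add_distrib, ← Finset.mul_sum, Finset.sum_sub_distrib] at h1
        simp only [Finset.sum_const, Finset.card_univ, Fintype.card_fin, nsmul_eq_mul] at h1
        rw [hFB t htI, mul_div_cancel₀ _ hn'.ne', sub_self, mul_zero, add_zero] at h1
        exact h1
      have hCS : (∑ i, G (X t i) * v i) ^ 2
          ≤ (∑ i, G (X t i) ^ 2 / G₂ (X t i)) * ∑ i, G₂ (X t i) * v i * v i := by
        refine Finset.sum_sq_le_sum_mul_sum_of_sq_le_mul _ (fun i _ => ?_) (fun i _ => ?_)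
          fun i _ => le_of_eq ?_
        · have := hpos₂ _ (hX t htI i)
          positivity
        · have := hpos₂ _ (hX t htI i)
          rw [mul_assoc]
          exact mul_nonneg this.le (mul_self_nonneg _)
        · have := (hpos₂ _ (hX t htI i)).ne'
          field_simp
      have hB₂0 : 0 ≤ ∑ i, G₂ (X t i) * v i * v i := Finset.sum_nonneg fun i _ => by
        have := hpos₂ _ (hX t htI i)
        rw [mul_assoc]
        exact mul_nonneg this.le (mul_self_nonneg _)
      have h2 := hCS.trans (mul_le_mul_of_nonneg_right hA hB₂0)
      have h3 : B₁ t ^ 2 ≤ G (F t) ^ 2 / G₂ (F t) * B₂ t := by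
        simp only [B₁, B₂]
        rw [div_pow, div_le_iff₀ (by positivity)]
        refine h2.trans_eq ?_
        field_simp
      rw [sub_nonneg, show B₁ t * (G₂ (F t) * (B₁ t / G (F t)))
        = B₁ t ^ 2 * (G₂ (F t) / G (F t)) by ring]
      refine (mul_le_mul_of_nonneg_right h3 (div_pos hGF₂ hGF).le).trans_eq ?_
      field_simp
  have hfin := hconv.2 (left_mem_Icc.2 zero_le_one) (right_mem_Icc.2 zero_le_one)
    (show (0 : ℝ) ≤ 1 / 2 by norm_num) (show (0 : ℝ) ≤ 1 / 2 by norm_num) (by norm_num)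
  have e0 : X 0 = x := by simp [X]
  have e1 : X 1 = y := by simp [X]
  have e2 : X ((1 / 2 : ℝ) • 0 + (1 / 2 : ℝ) • 1) = midpoint ℝ x y := by
    rw [midpoint_eq_smul_add, invOf_eq_inv]
    simp only [X, smul_eq_mul]
    module
  simp only [F] at hfin
  rw [e0, e1, e2, smul_eq_mul, smul_eq_mul] at hfin
  linarith

/-- Contraction towards an interior point commutes with midpoints and moves tuples into the
interior; continuity of `N` undoes it in the limit. -/
lemma IsMeanOf.jensenConvexOn_of_interior {I : Set ℝ} (hI : I.OrdConnected) (hne : I.Nontrivial)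
    {g : ℝ → ℝ} {N : MultiFun} (hN : IsMeanOf I g N) (hc : ContinuousOn g I)
    (hm : StrictMonoOn g I) (hJ : MultiJensenConvexOn (interior I) N) :
    MultiJensenConvexOn I N := by
  intro n hn x hx y hy
  obtain ⟨a, ha, b, hb, hab⟩ := hne.exists_lt
  obtain ⟨c, hc'⟩ := nonempty_Ioo.2 hab
  have hcU := hI.Ioo_subset_interior ha hb hc'
  set S : (Fin n → ℝ) → ℝ → Fin n → ℝ := fun z s => (1 - s) • z + s • fun _ => c
  have hS : ∀ z ∈ cube I n, ∀ s ∈ Ioo (0 : ℝ) 1, S z s ∈ cube (interior I) n := by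
    intro z hz s hs i
    have := hI.convex.combo_self_interior_mem_interior (hz i) hcU
      (a := 1 - s) (b := s) (by linarith [hs.2]) hs.1 (by ring)
    exact this
  have hNc := hN.continuousOn hI hc hm hn
  have hlim : ∀ z ∈ cube I n, Tendsto (fun s => N n (S z s)) (𝓝[>] 0) (𝓝 (N n z)) := by
    intro z hz
    refine (hNc z hz).tendsto.comp (tendsto_nhdsWithin_iff.2 ⟨?_, ?_⟩)
    · have : Continuous (S z) := by simp only [S]; fun_prop
      have h0 : S z 0 = z := by simp [S]
      have h1 := (this.tendsto 0).mono_left (nhdsWithin_le_nhds (s := Ioi 0))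
      rwa [h0] at h1
    · filter_upwards [Ioo_mem_nhdsGT (zero_lt_one (α := ℝ))] with s hs i
      exact interior_subset (hS z hz s hs i)
  have hmid : midpoint ℝ x y ∈ cube I n := (convex_cube hI n).midpoint_mem hx hy
  refine le_of_tendsto_of_tendsto (hlim _ hmid) (((hlim x hx).add (hlim y hy)).div_const 2) ?_
  filter_upwards [Ioo_mem_nhdsGT (zero_lt_one (α := ℝ))] with s hs
  have := hJ n hn _ (hS x hx s hs) _ (hS y hy s hs)
  have e : midpoint ℝ (S x s) (S y s) = S (midpoint ℝ x y) s := by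
    simp only [S, midpoint_eq_smul_add, invOf_eq_inv]
    module
  rwa [e] at this

/-! ### Primitives and concave envelopes -/

lemma exists_primitive {I : Set ℝ} (hI : I.OrdConnected) {u : ℝ → ℝ} (hu : ContinuousOn u I) :
    ∃ V : ℝ → ℝ, ∀ x ∈ I, HasDerivWithinAt V (u x) I x := by
  rcases I.eq_empty_or_nonempty with rfl | ⟨c, hc⟩
  · exact ⟨0, by simp⟩
  refine ⟨fun x => ∫ t in c..x, u t, fun x hx => ?_⟩
  have hint : ∀ a ∈ I, ∀ b ∈ I, IntervalIntegrable u MeasureTheory.volume a b := fun a ha b hb =>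
    (hu.mono (hI.uIcc_subset ha hb)).intervalIntegrable
  rw [hasDerivWithinAt_iff_isLittleO, Asymptotics.isLittleO_iff]
  intro ε hε
  obtain ⟨δ, hδ, hball⟩ := Metric.continuousWithinAt_iff.1 (hu x hx) ε hε
  filter_upwards [self_mem_nhdsWithin, mem_nhdsWithin_of_mem_nhds (Metric.ball_mem_nhds x hδ)]
    with z hz hzδ
  have e : (∫ t in c..z, u t) - (∫ t in c..x, u t) - (z - x) • u x = ∫ t in x..z, (u t - u x) := by
    rw [intervalIntegral.integral_interval_sub_left (hint c hc z hz) (hint c hc x hx),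
      intervalIntegral.integral_sub (hint x hx z hz) intervalIntegrable_const,
      intervalIntegral.integral_const]
  rw [e, Real.norm_eq_abs (z - x)]
  refine intervalIntegral.norm_integral_le_of_norm_le_const fun t ht => ?_
  have htI : t ∈ I := hI.uIcc_subset hx hz (uIoc_subset_uIcc ht)
  refine (hball htI ?_).le
  rw [dist_comm]
  exact (Real.dist_left_le_of_mem_uIcc (uIoc_subset_uIcc ht)).trans_lt (by rwa [dist_comm])

lemma _root_.ConcaveOn.exists_affine_ge {U : Set ℝ} (hU : IsOpen U) {k : ℝ → ℝ}
    (hk : ConcaveOn ℝ U k) {y : ℝ} (hy : y ∈ U) :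
    ∃ c : ℝ, ∀ x ∈ U, k x ≤ k y + c * (x - y) := by
  have hκ := hk.neg
  have hyi : y ∈ interior U := by rwa [hU.interior_eq]
  refine ⟨-derivWithin (-k) (Ioi y) y, fun x hx => ?_⟩
  rcases lt_trichotomy x y with h | rfl | h
  · have h1 := (hκ.slope_le_leftDeriv_of_mem_interior hx hyi h).trans
      (hκ.leftDeriv_le_rightDeriv_of_mem_interior hyi)
    rw [slope_def_field, div_le_iff₀ (sub_pos.2 h)] at h1
    simp only [Pi.neg_apply] at h1
    linarith
  · simp
  · have h1 := hκ.rightDeriv_le_slope_of_mem_interior hyi hx h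
    rw [slope_def_field, le_div_iff₀ (sub_pos.2 h)] at h1
    simp only [Pi.neg_apply] at h1
    linarith

/-- On each side of `x` where `I` has points, `k` lies above a chord starting at `(x, k x)`. This
covers endpoints as well. -/
lemma _root_.ConcaveOn.eventually_lt_nhdsWithin {I : Set ℝ} {k : ℝ → ℝ} (hk : ConcaveOn ℝ I k)
    {x a : ℝ} (hx : x ∈ I) (ha : a < k x) : ∀ᶠ z in 𝓝[I] x, a < k z := by
  have key : ∀ y ∈ I, ∀ᶠ z in 𝓝 x, z ∈ uIcc x y → a < k z := by
    intro y hy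
    rcases eq_or_ne x y with rfl | hxy
    · refine Eventually.of_forall fun z hz => ?_
      rw [uIcc_self] at hz
      rwa [mem_singleton_iff.1 hz]
    · have hyx : y - x ≠ 0 := sub_ne_zero.2 hxy.symm
      have hcont : Continuous fun z => (1 - (z - x) / (y - x)) * k x + (z - x) / (y - x) * k y := by
        fun_prop
      have hlim := hcont.tendsto x
      simp only [sub_self, zero_div, sub_zero, one_mul, zero_mul, add_zero] at hlim
      filter_upwards [hlim.eventually_const_lt ha] with z hz hzu
      have hθ : (z - x) / (y - x) ∈ Icc (0 : ℝ) 1 := by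
        rcases le_total x y with h | h
        · rw [uIcc_of_le h] at hzu
          have hp : 0 < y - x := lt_of_le_of_ne (by linarith) hyx.symm
          exact ⟨div_nonneg (by linarith [hzu.1]) hp.le,
            (div_le_one hp).2 (by linarith [hzu.2])⟩
        · rw [uIcc_of_ge h] at hzu
          have hp : y - x < 0 := lt_of_le_of_ne (by linarith) hyx
          exact ⟨div_nonneg_of_nonpos (by linarith [hzu.2]) hp.le,
            (div_le_one_of_neg hp).2 (by linarith [hzu.1])⟩
      have := hk.2 hx hy (sub_nonneg.2 hθ.2) hθ.1 (by ring)
      simp only [smul_eq_mul] at this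
      have e : (1 - (z - x) / (y - x)) * x + (z - x) / (y - x) * y = z := by
        field_simp
        ring
      rw [e] at this
      exact hz.trans_le this
  have hside : ∀ p : ℝ → Prop, (∀ y, p y → ∀ z ∈ I, p z → z ∈ uIcc x y ∨ y ∈ uIcc x z) →
      ∀ᶠ z in 𝓝[I] x, p z → a < k z := by
    intro p hp
    by_cases hex : ∃ y ∈ I, p y ∧ y ≠ x
    · obtain ⟨y, hy, hpy, hyx⟩ := hex
      have hfar : ∀ᶠ z in 𝓝 x, dist z x < dist y x :=
        Metric.ball_mem_nhds x (dist_pos.2 hyx)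
      filter_upwards [self_mem_nhdsWithin, nhdsWithin_le_nhds (key y hy),
        nhdsWithin_le_nhds hfar] with z hz hk1 hd hpz
      rcases hp y hpy z hz hpz with h | h
      · exact hk1 h
      · have h3 : |y - x| ≤ |z - x| := abs_sub_left_of_mem_uIcc h
        rw [Real.dist_eq, Real.dist_eq] at hd
        exact absurd hd (not_lt.2 h3)
    · push Not at hex
      filter_upwards [self_mem_nhdsWithin] with z hz hpz
      rwa [hex z hz hpz]
  have h1 := hside (fun z => x ≤ z) fun y hy z _ hz => by
    rw [uIcc_of_le hy, uIcc_of_le hz]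
    exact (le_total z y).imp (fun h => ⟨hz, h⟩) fun h => ⟨hy, h⟩
  have h2 := hside (fun z => z ≤ x) fun y hy z _ hz => by
    rw [uIcc_of_ge hy, uIcc_of_ge hz]
    exact (le_total y z).imp (fun h => ⟨h, hz⟩) fun h => ⟨h, hy⟩
  filter_upwards [h1, h2] with z hz1 hz2
  exact (le_total x z).elim hz1 hz2

/-- The affine majorants of `φ` on `I`, as pairs of slope and intercept. -/
def affineMajorants (I : Set ℝ) (φ : ℝ → ℝ) : Set (ℝ × ℝ) := {p | ∀ y ∈ I, φ y ≤ p.1 * y + p.2}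

/-- The infimum of the affine majorants of `φ` on `I`. -/
noncomputable def affineEnvelope (I : Set ℝ) (φ : ℝ → ℝ) (x : ℝ) : ℝ :=
  ⨅ p : affineMajorants I φ, p.1.1 * x + p.1.2

section AffineEnvelope

variable {I : Set ℝ} {φ : ℝ → ℝ}

lemma affineEnvelope_le {p : ℝ × ℝ} (hp : p ∈ affineMajorants I φ) {x : ℝ} (hx : x ∈ I) :
    affineEnvelope I φ x ≤ p.1 * x + p.2 :=
  ciInf_le (f := fun p : affineMajorants I φ => p.1.1 * x + p.1.2)
    ⟨φ x, by rintro _ ⟨q, rfl⟩; exact q.2 x hx⟩ ⟨p, hp⟩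

lemma le_affineEnvelope (hne : (affineMajorants I φ).Nonempty) {x : ℝ} (hx : x ∈ I) :
    φ x ≤ affineEnvelope I φ x :=
  have := hne.to_subtype
  le_ciInf fun p => p.2 x hx

lemma concaveOn_affineEnvelope (hI : I.OrdConnected) (hne : (affineMajorants I φ).Nonempty) :
    ConcaveOn ℝ I (affineEnvelope I φ) := by
  refine ⟨hI.convex, fun x hx y hy a b ha hb hab => ?_⟩
  have := hne.to_subtype
  refine le_ciInf fun p => ?_
  have h1 := mul_le_mul_of_nonneg_left (affineEnvelope_le p.2 hx) ha
  have h2 := mul_le_mul_of_nonneg_left (affineEnvelope_le p.2 hy) hb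
  simp only [smul_eq_mul]
  obtain rfl : a = 1 - b := by linarith
  linarith

/-- Lower semicontinuity comes from concavity, upper from being an infimum of affine functions; the
latter is what concavity lacks at endpoints. -/
lemma continuousOn_affineEnvelope (hI : I.OrdConnected) (hne : (affineMajorants I φ).Nonempty) :
    ContinuousOn (affineEnvelope I φ) I := by
  intro x hx
  refine tendsto_order.2 ⟨fun a ha =>
    (concaveOn_affineEnvelope hI hne).eventually_lt_nhdsWithin hx ha, fun b hb => ?_⟩
  have := hne.to_subtype
  obtain ⟨p, hp⟩ := exists_lt_of_ciInf_lt hb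
  have hcont : Continuous fun z => p.1.1 * z + p.1.2 := by fun_prop
  filter_upwards [self_mem_nhdsWithin,
    nhdsWithin_le_nhds ((hcont.tendsto x).eventually_lt_const hp)] with z hz hlt
  exact (affineEnvelope_le p.2 hz).trans_lt hlt

/-- The support line of `k` at `x` majorizes `φ` inside, and on all of `I` by continuity of `φ`, so
`k` need not extend to the endpoints. -/
lemma affineEnvelope_le_of_concaveOn (hI : I.OrdConnected) (hnt : I.Nontrivial)
    (hφ : ContinuousOn φ I) {k : ℝ → ℝ} (hk : ConcaveOn ℝ (interior I) k)
    (hle : ∀ y ∈ interior I, φ y ≤ k y) {x : ℝ} (hx : x ∈ interior I) :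
    affineEnvelope I φ x ≤ k x := by
  obtain ⟨c, hc⟩ := hk.exists_affine_ge isOpen_interior hx
  have hp : (c, k x - c * x) ∈ affineMajorants I φ := by
    refine le_on_of_le_on_interior hI hnt hφ (v := fun y => c * y + (k x - c * x))
      (Continuous.continuousOn (by fun_prop)) fun y hy => (hle y hy).trans ((hc y hy).trans_eq ?_)
    ring
  refine (affineEnvelope_le hp (interior_subset hx)).trans_eq ?_
  simp

lemma concEnvelope_eq_affineEnvelope (hI : I.OrdConnected) (hnt : I.Nontrivial)
    (hφ : ContinuousOn φ I) (hne : (affineMajorants I φ).Nonempty) {x : ℝ} (hx : x ∈ I) :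
    concEnvelope I {k : ℝ → ℝ | ContinuousOn k I} φ x = (affineEnvelope I φ x : EReal) := by
  have hc := continuousOn_affineEnvelope hI hne
  refine le_antisymm (sInf_le ⟨_, hc, (concaveOn_affineEnvelope hI hne).jensenConcaveOn,
    fun y hy => le_affineEnvelope hne hy, rfl⟩) (le_sInf ?_)
  rintro _ ⟨k, hk, hJ, hle, rfl⟩
  have hk : ContinuousOn k I := hk
  refine EReal.coe_le_coe_iff.2 (le_on_of_le_on_interior hI hnt hc hk (fun y hy => ?_) x hx)
  exact affineEnvelope_le_of_concaveOn hI hnt hφ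
    ((hJ.concaveOn hI.convex hk).subset interior_subset hI.convex.interior)
    (fun y hy => hle y (interior_subset hy)) hy

end AffineEnvelope

/-! ### Generators of class `C²` -/

section Smooth

variable {I : Set ℝ}

lemma uniqueDiffOn_of_ordConnected (hI : I.OrdConnected) (hne : I.Nontrivial) :
    UniqueDiffOn ℝ I := by
  obtain ⟨a, ha, b, hb, hab⟩ := hne.exists_lt
  exact uniqueDiffOn_convex hI.convex
    ((nonempty_Ioo.2 hab).mono (hI.Ioo_subset_interior ha hb))

lemma mem_C2sharp_of_hasDerivWithinAt (hI : I.OrdConnected) (hne : I.Nontrivial)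
    {g G G₂ : ℝ → ℝ} (hg : ∀ x ∈ I, HasDerivWithinAt g (G x) I x)
    (hG : ∀ x ∈ I, HasDerivWithinAt G (G₂ x) I x) (hG₂ : ContinuousOn G₂ I)
    (h0 : ∀ x ∈ I, G x ≠ 0) :
    g ∈ C2sharp I ∧ (∀ x ∈ I, d1 I g x = G x) ∧ ∀ x ∈ I, d2 I g x = G₂ x := by
  have hu := uniqueDiffOn_of_ordConnected hI hne
  have h1 : ∀ x ∈ I, derivWithin g I x = G x := fun x hx => (hg x hx).derivWithin (hu x hx)
  have hd : ∀ x ∈ I, HasDerivWithinAt (derivWithin g I) (G₂ x) I x := fun x hx =>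
    (hG x hx).congr h1 (h1 x hx)
  have h2 : ∀ x ∈ I, derivWithin (derivWithin g I) I x = G₂ x := fun x hx =>
    (hd x hx).derivWithin (hu x hx)
  refine ⟨⟨?_, fun x hx => by rw [d1, h1 x hx]; exact h0 x hx⟩, h1, h2⟩
  rw [show (2 : WithTop ℕ∞) = 1 + 1 by norm_num, contDiffOn_succ_iff_derivWithin hu]
  refine ⟨fun x hx => (hg x hx).differentiableWithinAt, by simp, ?_⟩
  rw [show (1 : WithTop ℕ∞) = 0 + 1 by norm_num, contDiffOn_succ_iff_derivWithin hu]
  refine ⟨fun x hx => (hd x hx).differentiableWithinAt, by simp, ?_⟩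
  exact contDiffOn_zero.2 (hG₂.congr h2)

lemma hasDerivWithinAt_of_mem_C2sharp (hI : I.OrdConnected) (hne : I.Nontrivial) {f : ℝ → ℝ}
    (hf : f ∈ C2sharp I) :
    (∀ x ∈ I, HasDerivWithinAt f (d1 I f x) I x) ∧
      (∀ x ∈ I, HasDerivWithinAt (d1 I f) (d2 I f x) I x) ∧ ContinuousOn (d2 I f) I := by
  have hu := uniqueDiffOn_of_ordConnected hI hne
  have h := hf.1
  rw [show (2 : WithTop ℕ∞) = 1 + 1 by norm_num, contDiffOn_succ_iff_derivWithin hu] at h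
  refine ⟨fun x hx => (h.1 x hx).hasDerivWithinAt, fun x hx =>
    ((h.2.2.differentiableOn one_ne_zero) x hx).hasDerivWithinAt, ?_⟩
  exact h.2.2.continuousOn_derivWithin hu le_rfl

lemma hasDerivAt_interior {g G : ℝ → ℝ} (hg : ∀ x ∈ I, HasDerivWithinAt g (G x) I x) :
    ∀ x ∈ interior I, HasDerivAt g (G x) x := fun x hx =>
  (hg x (interior_subset hx)).hasDerivAt (mem_interior_iff_mem_nhds.1 hx)

lemma RightC2.of_hasDerivWithinAt {g G G₂ : ℝ → ℝ}
    (hg : ∀ x ∈ I, HasDerivWithinAt g (G x) I x)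
    (hG : ∀ x ∈ I, HasDerivWithinAt G (G₂ x) I x) (hpos : ∀ x ∈ I, 0 < G x) :
    RightC2 (interior I) g G G₂ where
  pos y hy := hpos y (interior_subset hy)
  cont y hy := (hasDerivAt_interior hG y hy).continuousAt.continuousWithinAt
  hasDeriv y hy := (hasDerivAt_interior hg y hy).hasDerivWithinAt
  hasDeriv₂ y hy := (hasDerivAt_interior hG y hy).hasDerivWithinAt

lemma strictMonoOn_of_hasDerivWithinAt (hI : I.OrdConnected) {g G : ℝ → ℝ}
    (hg : ∀ x ∈ I, HasDerivWithinAt g (G x) I x) (hpos : ∀ x ∈ I, 0 < G x) :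
    StrictMonoOn g I := by
  refine strictMonoOn_of_deriv_pos hI.convex (fun x hx => (hg x hx).continuousWithinAt)
    fun x hx => ?_
  rw [(hasDerivAt_interior hg x hx).deriv]
  exact hpos x (interior_subset hx)

end Smooth

/-! ### The envelope as a greatest element, and the theorem -/

lemma convEnvelope_eq {I : Set ℝ} {S : Set MultiFun} {M N₀ : MultiFun} (hS : N₀ ∈ S)
    (hJ : MultiJensenConvexOn I N₀) (hle : MultiLeOn I N₀ M)
    (hmax : ∀ N ∈ S, MultiJensenConvexOn I N → MultiLeOn I N M → MultiLeOn I N N₀)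
    {n : ℕ} (hn : 0 < n) {x : Fin n → ℝ} (hx : x ∈ cube I n) :
    convEnvelope I S M n x = (N₀ n x : EReal) := by
  refine le_antisymm (sSup_le ?_) (le_sSup ⟨N₀, hS, hJ, hle, rfl⟩)
  rintro _ ⟨N, hN, hNJ, hNM, rfl⟩
  exact EReal.coe_le_coe_iff.2 (hmax N hN hNJ hNM n hn x hx)

lemma qaMean_id {I : Set ℝ} (hI : I.OrdConnected) {n : ℕ} (hn : 0 < n) {x : Fin n → ℝ}
    (hx : x ∈ cube I n) : qaMean I id n x = (∑ i, x i) / (n : ℝ) :=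
  (isMeanOf_qaMean hI continuousOn_id).eq n hn x hx

lemma jensenConvexOn_qaMean_id {I : Set ℝ} (hI : I.OrdConnected) :
    MultiJensenConvexOn I (qaMean I id) := by
  intro n hn x hx y hy
  rw [qaMean_id hI hn hx, qaMean_id hI hn hy,
    qaMean_id hI hn ((convex_cube hI n).midpoint_mem hx hy)]
  simp only [midpoint_eq_smul_add, invOf_eq_inv, Pi.smul_apply, Pi.add_apply, smul_eq_mul,
    ← Finset.mul_sum, Finset.sum_add_distrib]
  exact le_of_eq (by ring)

end QAEnvelope

open QAEnvelope in
theorem theorem3p2 (I : Set ℝ) (hI : I.OrdConnected) (hne : I.Nontrivial)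
    (f : ℝ → ℝ) (hf : f ∈ QAEnvelope.C2sharp I) (hmono : StrictMonoOn f I)
    (hconv : ConvexOn ℝ I f) :
    ∃ g ∈ QAEnvelope.C2sharp I,
      (∀ n : ℕ, 0 < n → ∀ x ∈ QAEnvelope.cube I n,
        QAEnvelope.convEnvelope I (QAEnvelope.qaFamily I) (QAEnvelope.qaMean I f) n x
          = (QAEnvelope.qaMean I g n x : EReal)) ∧
      (((∀ x ∈ I, QAEnvelope.d2 I g x = 0) ∧
          ∀ n : ℕ, 0 < n → ∀ x ∈ QAEnvelope.cube I n,
            QAEnvelope.qaMean I g n x = (∑ i, x i) / (n : ℝ)) ∨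
        ((∀ x ∈ I, QAEnvelope.d2 I g x ≠ 0) ∧ (∀ x ∈ I, QAEnvelope.d2 I f x ≠ 0) ∧
          ∀ x ∈ I, ((QAEnvelope.d1 I g x / QAEnvelope.d2 I g x : ℝ) : EReal) =
            QAEnvelope.concEnvelope I {k : ℝ → ℝ | ContinuousOn k I}
              (fun y => QAEnvelope.d1 I f y / QAEnvelope.d2 I f y) x)) := by
  obtain ⟨hf₁, hf₂, hf₂c⟩ := hasDerivWithinAt_of_mem_C2sharp hI hne hf
  have hfc : ContinuousOn f I := fun x hx => (hf₁ x hx).continuousWithinAt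
  have hf₁c : ContinuousOn (d1 I f) I := fun x hx => (hf₂ x hx).continuousWithinAt
  have hUI : interior I ⊆ I := interior_subset
  have hpos : ∀ x ∈ I, 0 < d1 I f x := fun x hx =>
    lt_of_le_of_ne hmono.monotoneOn.derivWithin_nonneg (hf.2 x hx).symm
  have hnonneg : ∀ x ∈ I, 0 ≤ d2 I f x := fun x hx =>
    (hconv.monotoneOn_derivWithin fun y hy =>
      (hf₁ y hy).differentiableWithinAt).derivWithin_nonneg
  have hfR := RightC2.of_hasDerivWithinAt hf₁ hf₂ hpos
  have hfM := isMeanOf_qaMean hI hfc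
  -- An affine majorant of `f'/f''`, written without division: since `f' > 0`, its existence already
  -- excludes zeros of `f''`.
  by_cases hA : ∃ p : ℝ × ℝ, ∀ x ∈ I, d1 I f x ≤ (p.1 * x + p.2) * d2 I f x
  · obtain ⟨p, hp⟩ := hA
    have hf₂ne : ∀ x ∈ I, d2 I f x ≠ 0 := fun x hx h0 => by
      have h1 := hp x hx
      rw [h0, mul_zero] at h1
      exact h1.not_gt (hpos x hx)
    have hf₂pos : ∀ x ∈ I, 0 < d2 I f x := fun x hx =>
      lt_of_le_of_ne (hnonneg x hx) (hf₂ne x hx).symm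
    set φ : ℝ → ℝ := fun y => d1 I f y / d2 I f y
    have hφc : ContinuousOn φ I := hf₁c.div hf₂c hf₂ne
    have hS : (affineMajorants I φ).Nonempty :=
      ⟨p, fun y hy => (div_le_iff₀ (hf₂pos y hy)).2 (hp y hy)⟩
    set ψ := affineEnvelope I φ
    have hψc : ContinuousOn ψ I := continuousOn_affineEnvelope hI hS
    have hφψ : ∀ x ∈ I, φ x ≤ ψ x := fun x hx => le_affineEnvelope hS hx
    have hψpos : ∀ x ∈ I, 0 < ψ x := fun x hx =>
      (div_pos (hpos x hx) (hf₂pos x hx)).trans_le (hφψ x hx)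
    -- `g'/g'' = ψ` says `(log g')' = 1/ψ`, so `g'` is the exponential of a primitive of `1/ψ`.
    obtain ⟨L, hL⟩ := exists_primitive hI
      (hψc.inv₀ fun x hx => (hψpos x hx).ne')
    have hG : ∀ x ∈ I, HasDerivWithinAt (fun x => Real.exp (L x))
        (Real.exp (L x) * (ψ x)⁻¹) I x := fun x hx => (hL x hx).exp
    have hGc : ContinuousOn (fun x => Real.exp (L x)) I := fun x hx =>
      (hG x hx).continuousWithinAt
    obtain ⟨g, hg⟩ := exists_primitive hI hGc
    set G : ℝ → ℝ := fun x => Real.exp (L x)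
    set G₂ : ℝ → ℝ := fun x => Real.exp (L x) * (ψ x)⁻¹
    have hGpos : ∀ x ∈ I, 0 < G x := fun x _ => Real.exp_pos _
    have hG₂pos : ∀ x ∈ I, 0 < G₂ x := fun x hx =>
      mul_pos (Real.exp_pos _) (inv_pos.2 (hψpos x hx))
    have hG₂c : ContinuousOn G₂ I := hGc.mul (hψc.inv₀ fun x hx => (hψpos x hx).ne')
    have hratio : ∀ x ∈ I, G x / G₂ x = ψ x := fun x hx => by
      have := (hψpos x hx).ne'
      simp only [G, G₂]
      field_simp
    have hratio' : ∀ x ∈ I, G₂ x / G x = (ψ x)⁻¹ := fun x hx => by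
      rw [← hratio x hx, inv_div]
    obtain ⟨hgC, hg1, hg2⟩ := mem_C2sharp_of_hasDerivWithinAt hI hne hg hG hG₂c
      fun x hx => (hGpos x hx).ne'
    have hgc : ContinuousOn g I := fun x hx => (hg x hx).continuousWithinAt
    have hgm := strictMonoOn_of_hasDerivWithinAt hI hg hGpos
    have hgR := RightC2.of_hasDerivWithinAt hg hG hGpos
    have hgM := isMeanOf_qaMean hI hgc
    have hgk : ConcaveOn ℝ (interior I) fun x => G x / G₂ x :=
      ((concaveOn_affineEnvelope hI hS).subset hUI hI.convex.interior).congr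
        fun x hx => (hratio x (hUI hx)).symm
    have hgJ : MultiJensenConvexOn I (qaMean I g) :=
      hgM.jensenConvexOn_of_interior hI hne hgc hgm
        ((hgM.mono hUI hI.interior hgc hgm).jensenConvexOn_of_isOpen isOpen_interior
          (hgm.mono hUI) (hasDerivAt_interior hg) (hasDerivAt_interior hG)
          (fun x hx => hGpos x (hUI hx)) (fun x hx => hG₂pos x (hUI hx)) hgk)
    have hgQ : qaMean I g ∈ qaFamily I := ⟨g, ⟨hgc, Or.inl hgm⟩, rfl⟩
    refine ⟨g, hgC, fun n hn x hx => convEnvelope_eq hgQ hgJ ?_ ?_ hn hx,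
      Or.inr ⟨fun x hx => ?_, hf₂ne, fun x hx => ?_⟩⟩
    · refine hgM.le_of_ratio_le hI hfM hgc hfc hgm hmono hgR hfR fun y hy => ?_
      rw [hratio' y (hUI hy), ← inv_div]
      exact inv_anti₀ (div_pos (hpos y (hUI hy)) (hf₂pos y (hUI hy))) (hφψ y (hUI hy))
    · intro N hN hNJ hNle
      obtain ⟨h, hc, hm, hNM⟩ := exists_increasing_generator hI hN
      obtain ⟨d, e, hde, hcase⟩ := hNM.structure_of_jensenConvex hI hc hm hNJ
      refine hNM.le_of_ratio_le hI hgM hc hgc hm hgm hde hgR fun y hy => ?_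
      rcases hcase with h0 | ⟨hepos, hk⟩
      · rw [h0 y hy, zero_div]
        exact div_nonneg (hG₂pos y (hUI hy)).le (hGpos y (hUI hy)).le
      -- The concave `d/e` majorizes `f'/f''` because `N` minorizes the mean of `f`.
      · have hψk : ψ y ≤ d y / e y := by
          refine affineEnvelope_le_of_concaveOn hI hne hφc hk (fun z hz => ?_) hy
          have h1 := hNM.ratio_le_of_le hI hfM hc hfc hm hmono hde hfR hNle hz
          have h2 := inv_anti₀ (div_pos (hepos z hz) (hde.pos z hz)) h1
          rwa [inv_div, inv_div] at h2
        rw [hratio' y (hUI hy), ← inv_div]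
        exact inv_anti₀ (hψpos y (hUI hy)) hψk
    · rw [hg2 x hx]
      exact (hG₂pos x hx).ne'
    · rw [hg1 x hx, hg2 x hx, hratio x hx]
      exact (concEnvelope_eq_affineEnvelope hI hne hφc hS hx).symm
  · have hid : ∀ x ∈ I, HasDerivWithinAt (id : ℝ → ℝ) 1 I x := fun x _ => hasDerivWithinAt_id x I
    have hid₂ : ∀ x ∈ I, HasDerivWithinAt (fun _ : ℝ => (1 : ℝ)) 0 I x := fun x _ =>
      hasDerivWithinAt_const x I 1
    obtain ⟨hgC, -, hg2⟩ := mem_C2sharp_of_hasDerivWithinAt hI hne hid hid₂ continuousOn_const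
      fun _ _ => one_ne_zero
    have hgR := RightC2.of_hasDerivWithinAt hid hid₂ fun _ _ => one_pos
    have hgm : StrictMonoOn (id : ℝ → ℝ) I := strictMono_id.strictMonoOn I
    have hgM := isMeanOf_qaMean hI (continuousOn_id (s := I))
    have hgQ : qaMean I id ∈ qaFamily I := ⟨id, ⟨continuousOn_id, Or.inl hgm⟩, rfl⟩
    refine ⟨id, hgC, fun n hn x hx => convEnvelope_eq hgQ
      (jensenConvexOn_qaMean_id hI) ?_ ?_ hn hx,
      Or.inl ⟨hg2, fun n hn x hx => qaMean_id hI hn hx⟩⟩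
    · refine hgM.le_of_ratio_le hI hfM continuousOn_id hfc hgm hmono hgR hfR fun y hy => ?_
      rw [zero_div]
      exact div_nonneg (hnonneg y (hUI hy)) (hpos y (hUI hy)).le
    · intro N hN hNJ hNle
      obtain ⟨h, hc, hm, hNM⟩ := exists_increasing_generator hI hN
      obtain ⟨d, e, hde, hcase⟩ := hNM.structure_of_jensenConvex hI hc hm hNJ
      refine hNM.le_of_ratio_le hI hgM hc continuousOn_id hm hgm hde hgR fun y hy => ?_
      rcases hcase with h0 | ⟨hepos, hk⟩
      · rw [h0 y hy, zero_div, zero_div]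
      -- A non-arithmetic competitor is impossible here: a support line of its `d/e` would be an
      -- affine majorant of the kind excluded by `hA`.
      · obtain ⟨c, hcy⟩ := hk.exists_affine_ge isOpen_interior hy
        refine absurd ⟨(c, d y / e y - c * y), ?_⟩ hA
        refine le_on_of_le_on_interior hI hne hf₁c
          (v := fun x => (c * x + (d y / e y - c * y)) * d2 I f x)
          (ContinuousOn.mul (Continuous.continuousOn (by fun_prop)) hf₂c) fun z hz => ?_
        have h1 := hNM.ratio_le_of_le hI hfM hc hfc hm hmono hde hfR hNle hz
        rw [div_le_div_iff₀ (hde.pos z hz) (hpos z (hUI hz))] at h1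
        have h2 : d1 I f z ≤ d z / e z * d2 I f z := by
          rw [div_mul_eq_mul_div, le_div_iff₀ (hepos z hz)]
          linarith
        refine h2.trans (mul_le_mul_of_nonneg_right ((hcy z hz).trans_eq ?_)
          (hnonneg z (hUI hz)))
        ring
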